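/- **Theorem 3.4.** For $\alpha, c \in (0,\infty)$ let $\mathfrak{D}_{\alpha,c}$ be the class of Borel probability density functions $v:\mathbb{R}\to[0,\infty)$ for which there is a function $C:[0,\infty)\to(0,\infty)$ with $\sup_y C(y)<\infty$ and $\lim_{y\to\infty}C(y)=c$ such that $v(y)=C(y)\,y^{-1-\alpha}$ for $y>0$ and $v(y)=0$ for $y\le 0$. Let $\alpha>1/2$ and $c_+,c_->0$, and let $v_+\in\mathfrak{D}_{\alpha,c_+}$ and $v_-\in\mathfrak{D}_{\alpha,c_-}$. Let $(Z_n)_{n\ge 0}$ be the corresponding antisymmetric one-sided oscillating random walk, i.e. a time-homogeneous Markov process on $\mathbb{R}$ such that, for every Borel set $B\subseteq\mathbb{R}$, $$\Pr[Z_{n+1}\in B\mid Z_n=x]=\begin{cases}\int_B v_+(x-z)\,dz & \text{if } x>0,\\[2pt] \int_B v_-(z-x)\,dz & \text{if } x<0,\end{cases}$$ with an arbitrary transition law at $x=0$. For $a>0$ let $\tau_a:=\min\{n\ge 0: |Z_n|\le a\}$ (with $\min\emptyset=+\infty$), and let $\mathbb{E}_x$ denote expectation for the process started from $Z_0=x$.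 Let $a>0$, $x\in\mathbb{R}\setminus[-a,a]$ and $q\in\mathbb{R}$. (i) If $\alpha\ge 1$, then $\mathbb{E}_x[\tau_a^q]<\infty$ if $q<\alpha$, and $\mathbb{E}_x[\tau_a^q]=\infty$ if $q>\alpha$. (ii) If $\alpha\in(1/2,1)$, then $\mathbb{E}_x[\tau_a^q]<\infty$ if $q<2-\frac1\alpha$, and $\mathbb{E}_x[\tau_a^q]=\infty$ if $q>2-\frac1\alpha$. -/

import Mathlib

open MeasureTheory ProbabilityTheory Filter Set
open scoped ENNReal Topology

/-- `v : ℝ → ℝ` is a (Borel, nonnegative) probability density function on the real line. -/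
structure IsProbDensity (v : ℝ → ℝ) : Prop where
  measurable : Measurable v
  nonneg : ∀ y, 0 ≤ v y
  lintegral_eq_one : ∫⁻ y, ENNReal.ofReal (v y) = 1

/-- The class `𝔇_{α,c}` of one-sided heavy-tailed densities: `v` is a probability density that
vanishes on `(-∞, 0]` and is `C(y) y^{-1-α}` at `y > 0`, where `C : [0, ∞) → (0, ∞)` is bounded
and tends to `c` at infinity. The values of the function `C` below at negative arguments play
no role. -/
structure IsHeavyTailedDensity (α c : ℝ) (v : ℝ → ℝ) : Prop where
  density : IsProbDensity v
  tail : ∃ C : ℝ → ℝ, (∀ y, 0 ≤ y → 0 < C y) ∧ BddAbove (C '' Ici 0) ∧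
    Tendsto C atTop (𝓝 c) ∧
    (∀ y, 0 < y → v y = C y * y ^ (-1 - α)) ∧ (∀ y, y ≤ 0 → v y = 0)

/-- `κ` is a transition kernel of the oscillating random walk with increment density `wp` on the
positive half-line and `wm` on the negative half-line: started from `x > 0`, the next position has
density `z ↦ wp (z - x)`; started from `x < 0`, it has density `z ↦ wm (z - x)`. The transition law
at the origin is arbitrary. -/
structure IsOscillatingKernel (wp wm : ℝ → ℝ) (κ : Kernel ℝ ℝ) : Prop where
  pos : ∀ x, 0 < x → ∀ B, MeasurableSet B → κ x B = ∫⁻ z in B, ENNReal.ofReal (wp (z - x))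
  neg : ∀ x, x < 0 → ∀ B, MeasurableSet B → κ x B = ∫⁻ z in B, ENNReal.ofReal (wm (z - x))

/-- On the probability space `(Ω, P)` the process `Z` is a time-homogeneous Markov chain, with
respect to the filtration `ℱ`, with transition kernel `κ` and initial state `x`. -/
structure IsMarkovChainFrom {Ω : Type*} {m : MeasurableSpace Ω} (P : Measure Ω)
    (ℱ : Filtration ℕ m) (κ : Kernel ℝ ℝ) (x : ℝ) (Z : ℕ → Ω → ℝ) : Prop where
  adapted : Adapted ℱ Z
  start : ∀ᵐ ω ∂P, Z 0 ω = x
  step : ∀ n, ∀ B : Set ℝ, MeasurableSet B →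
    P⟦Z (n + 1) ⁻¹' B | ℱ n⟧ =ᵐ[P] fun ω => (κ (Z n ω)).real B

/-- The passage time `τ_a = min {n ≥ 0 : |Z_n| ≤ a}`, equal to `∞` if there is no such `n`. -/
noncomputable def passageTime {Ω : Type*} (Z : ℕ → Ω → ℝ) (a : ℝ) : Ω → ℕ∞ :=
  hittingAfter Z {z | |z| ≤ a} 0

/-- The moment `E[τ_a ^ q]`, with values in `[0, ∞]`. -/
noncomputable def passageMoment {Ω : Type*} {m : MeasurableSpace Ω} (P : Measure Ω)
    (Z : ℕ → Ω → ℝ) (a q : ℝ) : ℝ≥0∞ :=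
  ∫⁻ ω, (passageTime Z a ω : ℝ≥0∞) ^ q ∂P

/-! Write r for the distance of the walk from 0. By antisymmetry the next distance is |r - Y|, with
Y drawn from `v₁` or `v₂` according to the side, so an estimate that holds under both laws holds for
one step of the distance (`lintegral_abs_induction`). The two tails share the index α, and R ^ α
times the law of Y / R converges to c u ^ (-1 - α) du (`tendsto_integral_comp_div`).

Finite moments come from the Lyapunov function r ^ ν. For α < 1 its drift is asymptotically c r ^ (ν
- α) times the integral of `driftIntegrand α ν`. That integral vanishes at ν = 2α - 1, thanks to an
explicit primitive, and strict convexity in the exponent makes it negative for 0 < ν < 2α - 1 and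
positive for 2α - 1 < ν < α. For α > 1 the drift is about -ν E[Y] r ^ (ν - 1) when 1 ≤ ν < α; for α
= 1 the limiting integral diverges to -∞ and the drift is at most -b r ^ (ν - 1) for every 0 < ν <
1. A drift -b r ^ (ν - γ), with γ = min α 1, makes (r ^ ν + L) ^ (γ / ν) behave like a clock running
down at a constant rate, and P(τ > N) = O(N ^ (-ν / γ)) follows. The exponent ν / γ can be taken up
to α, respectively (2α - 1) / α = 2 - 1 / α.

Infinite moments need lower bounds on survival. For α ≥ 1 a single first jump suffices: it exceeds
M, a power of N slightly above N itself, with probability of order M ^ (-α), and from there N steps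
typically do not bring the walk back. For α < 1 and ν slightly above 2α - 1, r ^ ν is a
submartingale far out. Truncated at S of order N ^ (1 / α), it loses at most a factor 1 - C S ^ (-α)
per step (`truncatedPower_le_integral`), hence a bounded factor in N steps, and survival has
probability at least of order S ^ (-ν), that is N ^ (-ν / α). -/

/-! ### Laws with a heavy-tailed density -/

/-- The measure on the line with Lebesgue density `v`. -/
noncomputable def densityLaw (v : ℝ → ℝ) : Measure ℝ :=
  volume.withDensity fun y => ENNReal.ofReal (v y)

namespace IsProbDensity

variable {v : ℝ → ℝ}

lemma isProbabilityMeasure (hv : IsProbDensity v) : IsProbabilityMeasure (densityLaw v) :=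
  ⟨by simp [densityLaw, hv.lintegral_eq_one]⟩

lemma integrable_iff (hv : IsProbDensity v) {g : ℝ → ℝ} :
    Integrable g (densityLaw v) ↔ Integrable fun y => v y * g y := by
  rw [densityLaw, integrable_withDensity_iff_integrable_smul' hv.measurable.ennreal_ofReal (by simp)]
  simp [ENNReal.toReal_ofReal (hv.nonneg _)]

lemma integral_eq (hv : IsProbDensity v) (g : ℝ → ℝ) :
    ∫ y, g y ∂densityLaw v = ∫ y, v y * g y := by
  rw [densityLaw, integral_withDensity_eq_integral_toReal_smul hv.measurable.ennreal_ofReal (by simp)]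
  simp [ENNReal.toReal_ofReal (hv.nonneg _)]

end IsProbDensity

namespace IsHeavyTailedDensity

variable {α c : ℝ} {v : ℝ → ℝ}

lemma eq_zero (hv : IsHeavyTailedDensity α c v) {y : ℝ} (hy : y ≤ 0) : v y = 0 := by
  obtain ⟨C, -, -, -, -, h⟩ := hv.tail
  exact h y hy

lemma pos (hv : IsHeavyTailedDensity α c v) {y : ℝ} (hy : 0 < y) : 0 < v y := by
  obtain ⟨C, hC, -, -, h, -⟩ := hv.tail
  rw [h y hy]
  have := hC y hy.le
  positivity

lemma rpow_mul_rpow_neg {y : ℝ} (hy : 0 < y) : y ^ (-1 - α) * y ^ (1 + α) = 1 := by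
  rw [← Real.rpow_add hy]
  simp

lemma exists_bound (hv : IsHeavyTailedDensity α c v) :
    ∃ K, ∀ y, 0 < y → v y * y ^ (1 + α) ≤ K := by
  obtain ⟨C, hC, ⟨K, hK⟩, -, h, -⟩ := hv.tail
  refine ⟨K, fun y hy => ?_⟩
  rw [h y hy, mul_assoc, rpow_mul_rpow_neg hy, mul_one]
  exact hK ⟨y, hy.le, rfl⟩

lemma tendsto (hv : IsHeavyTailedDensity α c v) :
    Tendsto (fun y => v y * y ^ (1 + α)) atTop (𝓝 c) := by
  obtain ⟨C, -, -, hC, h, -⟩ := hv.tail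
  refine hC.congr' ?_
  filter_upwards [eventually_gt_atTop 0] with y hy
  rw [h y hy, mul_assoc, rpow_mul_rpow_neg hy, mul_one]

lemma ae_pos (hv : IsHeavyTailedDensity α c v) : ∀ᵐ y ∂densityLaw v, 0 < y := by
  rw [densityLaw, ae_withDensity_iff hv.density.measurable.ennreal_ofReal]
  refine Eventually.of_forall fun y hy => ?_
  by_contra h
  exact hy (by simp [hv.eq_zero (not_lt.1 h)])

lemma integrable_iff (hv : IsHeavyTailedDensity α c v) {g : ℝ → ℝ} :
    Integrable g (densityLaw v) ↔ IntegrableOn (fun y => v y * g y) (Ioi 0) := by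
  rw [hv.density.integrable_iff, ← integrable_indicator_iff measurableSet_Ioi]
  refine iff_of_eq (congrArg (fun f => Integrable f volume) ?_)
  funext y
  by_cases hy : y ∈ Ioi (0 : ℝ)
  · rw [indicator_of_mem hy]
  · rw [indicator_of_notMem hy, hv.eq_zero (not_lt.1 hy), zero_mul]

lemma integral_eq (hv : IsHeavyTailedDensity α c v) (g : ℝ → ℝ) :
    ∫ y, g y ∂densityLaw v = ∫ y in Ioi 0, v y * g y := by
  rw [hv.density.integral_eq, ← integral_indicator measurableSet_Ioi]
  congr 1
  funext y
  by_cases hy : y ∈ Ioi (0 : ℝ)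
  · rw [indicator_of_mem hy]
  · rw [indicator_of_notMem hy, hv.eq_zero (not_lt.1 hy), zero_mul]

lemma scaling_identity (v φ : ℝ → ℝ) {R u : ℝ} (hR : 0 < R) (hu : 0 < u) :
    v (R * u) * φ (R * u / R) =
      R ^ (-1 - α) * ((v (R * u) * (R * u) ^ (1 + α)) * (φ u * u ^ (-1 - α))) := by
  rw [Real.mul_rpow hR.le hu.le, mul_div_cancel_left₀ _ hR.ne']
  have h1 := rpow_mul_rpow_neg (α := α) hR
  have h2 := rpow_mul_rpow_neg (α := α) hu
  calc _ = v (R * u) * φ u * (R ^ (-1 - α) * R ^ (1 + α)) * (u ^ (-1 - α) * u ^ (1 + α)) := by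
        rw [h1, h2]; ring
    _ = _ := by ring

lemma aestronglyMeasurable_scaled (hv : IsHeavyTailedDensity α c v) (R : ℝ) (μ : Measure ℝ) :
    AEStronglyMeasurable (fun u => v (R * u) * (R * u) ^ (1 + α)) μ := by
  have h1 : Measurable fun u : ℝ => R * u := by fun_prop
  exact ((hv.density.measurable.comp h1).mul (h1.pow_const _)).aestronglyMeasurable

lemma integrable_comp_div (hv : IsHeavyTailedDensity α c v) {φ : ℝ → ℝ}
    (hφ : IntegrableOn (fun u => φ u * u ^ (-1 - α)) (Ioi 0)) {R : ℝ} (hR : 0 < R) :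
    Integrable (fun y => φ (y / R)) (densityLaw v) := by
  obtain ⟨K, hK⟩ := hv.exists_bound
  rw [hv.integrable_iff]
  have h := (integrableOn_Ioi_comp_mul_left_iff (fun y => v y * φ (y / R)) 0 hR).1
  rw [mul_zero] at h
  refine h (IntegrableOn.congr_fun ?_ (fun u hu => (scaling_identity (α := α) v φ hR hu).symm)
    measurableSet_Ioi)
  refine Integrable.const_mul (Integrable.bdd_mul (c := K) hφ (hv.aestronglyMeasurable_scaled R _) ?_) _
  refine (ae_restrict_iff' measurableSet_Ioi).2 (Eventually.of_forall fun u hu => ?_)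
  have hRu : 0 < R * u := mul_pos hR hu
  rw [Real.norm_of_nonneg (mul_nonneg (hv.density.nonneg _) (by positivity))]
  exact hK _ hRu

/-- After the substitution y = R u the density contributes only v(Ru) (Ru) ^ (1 + α), which tends to
c and is bounded for all u > 0. Dominated convergence therefore needs nothing of φ near 0 beyond
integrability. -/
lemma tendsto_integral_comp_div (hv : IsHeavyTailedDensity α c v) {φ : ℝ → ℝ}
    (hφ : IntegrableOn (fun u => φ u * u ^ (-1 - α)) (Ioi 0)) :
    Tendsto (fun R => R ^ α * ∫ y, φ (y / R) ∂densityLaw v) atTop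
      (𝓝 (c * ∫ u in Ioi 0, φ u * u ^ (-1 - α))) := by
  obtain ⟨K, hK⟩ := hv.exists_bound
  have key : Tendsto (fun R => ∫ u in Ioi 0, (v (R * u) * (R * u) ^ (1 + α)) *
      (φ u * u ^ (-1 - α))) atTop (𝓝 (∫ u in Ioi 0, c * (φ u * u ^ (-1 - α)))) := by
    refine tendsto_integral_filter_of_dominated_convergence
      (fun u => K * ‖φ u * u ^ (-1 - α)‖) ?_ ?_ (hφ.norm.const_mul K) ?_
    · exact Eventually.of_forall fun R =>
        (hv.aestronglyMeasurable_scaled R _).mul hφ.aestronglyMeasurable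
    · filter_upwards [eventually_gt_atTop 0] with R hR
      refine (ae_restrict_iff' measurableSet_Ioi).2 (Eventually.of_forall fun u hu => ?_)
      have hRu : 0 < R * u := mul_pos hR hu
      rw [norm_mul, Real.norm_of_nonneg (mul_nonneg (hv.density.nonneg _) (by positivity))]
      gcongr
      exact hK _ hRu
    · refine (ae_restrict_iff' measurableSet_Ioi).2 (Eventually.of_forall fun u hu => ?_)
      exact (hv.tendsto.comp (tendsto_id.atTop_mul_const hu)).mul_const _
  rw [integral_const_mul] at key
  refine key.congr' ?_
  filter_upwards [eventually_gt_atTop 0] with R hR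
  have h := integral_comp_mul_left_Ioi' (fun y => v y * φ (y / R)) 0 hR
  rw [mul_zero] at h
  rw [hv.integral_eq, ← h, setIntegral_congr_fun measurableSet_Ioi
    (fun u hu => scaling_identity (α := α) v φ hR hu), integral_const_mul, smul_eq_mul]
  have h3 : R ^ α * R * R ^ (-1 - α) = 1 := by
    rw [← Real.rpow_add_one hR.ne', ← Real.rpow_add hR]
    ring_nf
    simp
  rw [← mul_assoc, ← mul_assoc, h3, one_mul]

lemma integral_comp_div_le (hv : IsHeavyTailedDensity α c v) {φ : ℝ → ℝ}
    (hφ : IntegrableOn (fun u => φ u * u ^ (-1 - α)) (Ioi 0)) {b : ℝ}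
    (hb : c * ∫ u in Ioi 0, φ u * u ^ (-1 - α) < b) :
    ∀ᶠ R in atTop, ∫ y, φ (y / R) ∂densityLaw v ≤ b * R ^ (-α) := by
  filter_upwards [(hv.tendsto_integral_comp_div hφ).eventually_lt_const hb,
    eventually_gt_atTop 0] with R hR h0
  have h : 0 < R ^ α := by positivity
  rw [Real.rpow_neg h0.le, ← div_eq_mul_inv, le_div_iff₀ h, mul_comm]
  exact hR.le

lemma le_integral_comp_div (hv : IsHeavyTailedDensity α c v) {φ : ℝ → ℝ}
    (hφ : IntegrableOn (fun u => φ u * u ^ (-1 - α)) (Ioi 0)) {b : ℝ}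
    (hb : b < c * ∫ u in Ioi 0, φ u * u ^ (-1 - α)) :
    ∀ᶠ R in atTop, b * R ^ (-α) ≤ ∫ y, φ (y / R) ∂densityLaw v := by
  filter_upwards [(hv.tendsto_integral_comp_div hφ).eventually_const_lt hb,
    eventually_gt_atTop 0] with R hR h0
  have h : 0 < R ^ α := by positivity
  rw [Real.rpow_neg h0.le, ← div_eq_mul_inv, div_le_iff₀ h, mul_comm]
  linarith

lemma integrableOn_indicator_rpow {α β : ℝ} (hβ : β < α) :
    IntegrableOn (fun u : ℝ => (Ioi (1 : ℝ)).indicator (fun u => u ^ β) u * u ^ (-1 - α))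
      (Ioi 0) := by
  have h1 : IntegrableOn (fun u : ℝ => u ^ (β - 1 - α)) (Ioi 1) :=
    integrableOn_Ioi_rpow_of_lt (by linarith) one_pos
  have h2 := (integrable_indicator_iff measurableSet_Ioi).2 h1
  refine (h2.integrableOn (s := Ioi 0)).congr_fun (fun u hu => ?_) measurableSet_Ioi
  by_cases hu1 : u ∈ Ioi (1 : ℝ)
  · simp only [indicator_of_mem hu1]
    rw [← Real.rpow_add hu]
    congr 1
    ring
  · simp [indicator_of_notMem hu1]

lemma integrable_rpow (hv : IsHeavyTailedDensity α c v) {β : ℝ} (h0 : 0 ≤ β) (hβ : β < α) :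
    Integrable (fun y => y ^ β) (densityLaw v) := by
  have := hv.density.isProbabilityMeasure
  have h3 := (hv.integrable_comp_div (integrableOn_indicator_rpow hβ) one_pos).add (integrable_const (1 : ℝ))
  refine h3.mono' (by fun_prop) ?_
  filter_upwards [hv.ae_pos] with y hy
  rw [Real.norm_of_nonneg (by positivity)]
  by_cases hy1 : y ∈ Ioi (1 : ℝ)
  · simp [indicator_of_mem hy1]
  · simpa [indicator_of_notMem hy1] using Real.rpow_le_one hy.le (not_lt.1 hy1) h0

/-- For r ≥ a the window (r - a, r + a) lies in (0, ∞), where v is positive. Its mass is continuous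
in r, so it has a positive minimum on a compact range: from moderate distances the target is hit in
one step with uniformly positive probability. -/
lemma exists_le_measure_near (hv : IsHeavyTailedDensity α c v) {a : ℝ} (ha : 0 < a) (A : ℝ) :
    ∃ δ > 0, ∀ r ∈ Icc a A, δ ≤ (densityLaw v).real {y | |r - y| ≤ a} := by
  have := hv.density.isProbabilityMeasure
  have hint : Integrable v := by
    have := (hv.density.integrable_iff (g := fun _ => 1)).1 (integrable_const _)
    simpa using this
  have hF : Continuous fun r : ℝ => ∫ y in (r - a)..(r + a), v y := by
    have h := intervalIntegral.continuous_primitive (fun a b => hint.intervalIntegrable) 0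
    have h2 : (fun r : ℝ => ∫ y in (r - a)..(r + a), v y) =
        fun r => (∫ y in (0 : ℝ)..(r + a), v y) - ∫ y in (0 : ℝ)..(r - a), v y := by
      funext r
      rw [intervalIntegral.integral_interval_sub_left] <;> exact hint.intervalIntegrable
    rw [h2]
    exact (h.comp (by fun_prop)).sub (h.comp (by fun_prop))
  have hpos : ∀ r ∈ Icc a A, 0 < ∫ y in (r - a)..(r + a), v y := by
    intro r hr
    exact intervalIntegral.intervalIntegral_pos_of_pos_on hint.intervalIntegrable
      (fun y hy => hv.pos (by linarith [hr.1, hy.1])) (by linarith)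
  have heq : ∀ r, (densityLaw v).real {y | |r - y| ≤ a} = ∫ y in (r - a)..(r + a), v y := by
    intro r
    have hs : {y | |r - y| ≤ a} = Icc (r - a) (r + a) := by
      ext y
      simp only [mem_ofPred_eq, mem_Icc, abs_le]
      constructor <;> rintro ⟨h1, h2⟩ <;> constructor <;> linarith
    rw [hs, ← integral_indicator_one measurableSet_Icc, hv.density.integral_eq,
      intervalIntegral.integral_of_le (by linarith), ← integral_Icc_eq_integral_Ioc,
      ← integral_indicator measurableSet_Icc]
    congr 1
    funext y
    by_cases hy : y ∈ Icc (r - a) (r + a) <;> simp [hy]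
  rcases (Icc a A).eq_empty_or_nonempty with h | h
  · exact ⟨1, one_pos, by simp [h]⟩
  · obtain ⟨r₀, hr₀, hmin⟩ := isCompact_Icc.exists_isMinOn h hF.continuousOn
    exact ⟨_, hpos r₀ hr₀, fun r hr => by rw [heq]; exact hmin hr⟩

end IsHeavyTailedDensity

/-! ### The sign of the limiting drift -/

/-- The integrand of the limiting drift of `|x| ^ ν`, scaled to `x = 1`, under jumps of intensity
`u ^ (-1 - α)`. -/
noncomputable def driftIntegrand (α ν u : ℝ) : ℝ := (|1 - u| ^ ν - 1) * u ^ (-1 - α)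

lemma measurable_driftIntegrand (α ν : ℝ) : Measurable (driftIntegrand α ν) := by
  unfold driftIntegrand
  fun_prop

lemma abs_rpow_sub_one_le {ν u : ℝ} (h0 : 0 ≤ ν) (h1 : ν ≤ 1) (hu0 : 0 ≤ u) (hu1 : u ≤ 1) :
    |(|1 - u| ^ ν - 1)| ≤ u := by
  rw [abs_of_nonneg (by linarith : (0 : ℝ) ≤ 1 - u)]
  have h2 : (1 - u) ^ ν ≤ 1 := Real.rpow_le_one (by linarith) (by linarith) h0
  have h3 : 1 - u ≤ (1 - u) ^ ν := by
    simpa using Real.rpow_le_rpow_of_exponent_ge' (by linarith : 0 ≤ 1 - u) (by linarith) h0 h1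
  rw [abs_le]
  constructor <;> linarith

lemma abs_rpow_sub_one_le_rpow {ν u : ℝ} (h0 : 0 ≤ ν) (hu1 : 1 ≤ u) :
    |(|1 - u| ^ ν - 1)| ≤ u ^ ν := by
  rw [abs_sub_comm 1 u, abs_of_nonneg (by linarith : (0 : ℝ) ≤ u - 1)]
  have h2 : (u - 1) ^ ν ≤ u ^ ν := Real.rpow_le_rpow (by linarith) (by linarith) h0
  have h3 : 1 ≤ u ^ ν := Real.one_le_rpow hu1 h0
  have h4 : 0 ≤ (u - 1) ^ ν := Real.rpow_nonneg (by linarith) _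
  rw [abs_le]
  constructor <;> linarith

/-- The integrand is O(u ^ (-α)) at 0, whence α < 1, and O(u ^ (ν - 1 - α)) at infinity, whence ν <
α. -/
lemma integrableOn_driftIntegrand {α ν : ℝ} (h0 : 0 ≤ ν) (hν : ν < α) (hα : α < 1) :
    IntegrableOn (driftIntegrand α ν) (Ioi 0) := by
  rw [← Ioc_union_Ioi_eq_Ioi (zero_le_one' ℝ)]
  refine IntegrableOn.union ?_ ?_
  · have h : IntegrableOn (fun u : ℝ => u ^ (-α)) (Ioc 0 1) :=
      (intervalIntegrable_iff_integrableOn_Ioc_of_le zero_le_one).1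
        (intervalIntegral.intervalIntegrable_rpow' (by linarith))
    refine h.mono' (measurable_driftIntegrand α ν).aestronglyMeasurable ?_
    refine (ae_restrict_iff' measurableSet_Ioc).2 (Eventually.of_forall fun u hu => ?_)
    have hu0 : 0 < u := hu.1
    have h1 : u ^ (-α) = u * u ^ (-1 - α) := by
      rw [← Real.rpow_one_add' hu0.le (by linarith)]
      ring_nf
    rw [driftIntegrand, norm_mul, Real.norm_eq_abs, Real.norm_of_nonneg (by positivity), h1]
    gcongr
    exact abs_rpow_sub_one_le h0 (by linarith) hu0.le hu.2
  · have h : IntegrableOn (fun u : ℝ => u ^ (ν - 1 - α)) (Ioi 1) :=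
      integrableOn_Ioi_rpow_of_lt (by linarith) one_pos
    refine h.mono' (measurable_driftIntegrand α ν).aestronglyMeasurable ?_
    refine (ae_restrict_iff' measurableSet_Ioi).2 (Eventually.of_forall fun u hu => ?_)
    have hu1 : 1 < u := hu
    have hu0 : 0 < u := by linarith
    have h1 : u ^ (ν - 1 - α) = u ^ ν * u ^ (-1 - α) := by
      rw [← Real.rpow_add hu0]
      ring_nf
    rw [driftIntegrand, norm_mul, Real.norm_eq_abs, Real.norm_of_nonneg (by positivity), h1]
    gcongr
    exact abs_rpow_sub_one_le_rpow h0 hu1.le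

/-- The substitution `u = 1 / s` on the half-line `(1, ∞)`. -/
lemma integral_sub_one_rpow {α : ℝ} :
    ∫ u in Ioi (1 : ℝ), (u - 1) ^ (2 * α - 1) * u ^ (-1 - α) =
      ∫ s in Ioo (0 : ℝ) 1, (1 - s) ^ (2 * α - 1) * s ^ (-α) := by
  have h := integral_comp_rpow_Ioi
    ((Ioi (1 : ℝ)).indicator fun u => (u - 1) ^ (2 * α - 1) * u ^ (-1 - α)) (p := -1) (by norm_num)
  rw [setIntegral_indicator measurableSet_Ioi, inter_eq_right.2 (Ioi_subset_Ioi zero_le_one)] at h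
  rw [← h, ← Ioi_inter_Iio, ← setIntegral_indicator measurableSet_Iio]
  refine setIntegral_congr_fun measurableSet_Ioi fun s hs => ?_
  have hs0 : 0 < s := hs
  by_cases hs1 : s < 1
  · have h1 : s ^ (-1 : ℝ) ∈ Ioi (1 : ℝ) := by
      rw [Real.rpow_neg_one]
      exact (one_lt_inv₀ hs0).2 hs1
    rw [indicator_of_mem h1, indicator_of_mem (mem_Iio.2 hs1)]
    have h2 : s ^ (-1 : ℝ) - 1 = (1 - s) * s ^ (-1 : ℝ) := by
      rw [Real.rpow_neg_one]
      field_simp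
    rw [h2, Real.mul_rpow (by linarith) (by positivity), ← Real.rpow_mul hs0.le,
      ← Real.rpow_mul hs0.le, smul_eq_mul]
    have h3 : s ^ (-α) = s ^ (-1 - 1 : ℝ) * (s ^ (-1 * (2 * α - 1)) * s ^ (-1 * (-1 - α))) := by
      rw [← Real.rpow_add hs0, ← Real.rpow_add hs0]
      ring_nf
    rw [h3]
    norm_num
    ring
  · have h1 : s ^ (-1 : ℝ) ∉ Ioi (1 : ℝ) := by
      rw [Real.rpow_neg_one, mem_Ioi, not_lt]
      exact inv_le_one_of_one_le₀ (not_lt.1 hs1)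
    rw [indicator_of_notMem h1, indicator_of_notMem (by simpa using hs1), smul_zero]

/-- The first summand is the part from (1, ∞) after inversion, the second the part from (0, 1). At
the exponent 2α - 1 their sum has an elementary primitive, although neither does in general; this
singles out 2α - 1. -/
lemma hasDerivAt_driftPrimitive {α s : ℝ} (hα : 0 < α) (hs0 : 0 < s) (hs1 : s < 1) :
    HasDerivAt (fun s => α⁻¹ * (s ^ (-α) * (1 - (1 - s) ^ (2 * α))))
      ((1 - s) ^ (2 * α - 1) * s ^ (-α) + ((1 - s) ^ (2 * α - 1) - 1) * s ^ (-1 - α)) s := by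
  have h1 : HasDerivAt (fun s : ℝ => s ^ (-α)) (-α * s ^ (-α - 1)) s :=
    Real.hasDerivAt_rpow_const (Or.inl hs0.ne')
  have h2 : HasDerivAt (fun s : ℝ => (1 - s) ^ (2 * α))
      ((-1) * (2 * α) * (1 - s) ^ (2 * α - 1)) s :=
    ((hasDerivAt_id s).const_sub 1).rpow_const (Or.inl (by simp; linarith))
  refine ((h1.mul (h2.const_sub 1)).const_mul α⁻¹).congr_deriv ?_
  have h3 : (1 - s) ^ (2 * α) = (1 - s) ^ (2 * α - 1) * (1 - s) := by
    rw [← Real.rpow_add_one (by linarith)]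
    ring_nf
  have h4 : s ^ (-α) = s * s ^ (-1 - α) := by
    rw [← Real.rpow_one_add' hs0.le (by linarith)]
    ring_nf
  have h5 : s ^ (-α - 1) = s ^ (-1 - α) := by ring_nf
  rw [h3, h4, h5]
  field_simp
  ring

lemma integrableOn_beta {α : ℝ} (hα : 1 / 2 < α) (hα1 : α < 1) :
    IntegrableOn (fun s : ℝ => (1 - s) ^ (2 * α - 1) * s ^ (-α)) (Ioo 0 1) := by
  have h : IntegrableOn (fun u : ℝ => u ^ (-α)) (Ioo 0 1) :=
    ((intervalIntegrable_iff_integrableOn_Ioc_of_le zero_le_one).1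
      (intervalIntegral.intervalIntegrable_rpow' (by linarith))).mono_set Ioo_subset_Ioc_self
  refine h.mono' (by fun_prop) ?_
  refine (ae_restrict_iff' measurableSet_Ioo).2 (Eventually.of_forall fun u hu => ?_)
  have hu0 : 0 < u := hu.1
  have hu1 : 0 < 1 - u := by linarith [hu.2]
  rw [Real.norm_of_nonneg (by positivity)]
  exact mul_le_of_le_one_left (by positivity)
    (Real.rpow_le_one hu1.le (by linarith) (by linarith))

lemma integral_driftIntegrand_eq_zero {α : ℝ} (hα : 1 / 2 < α) (hα1 : α < 1) :
    ∫ u in Ioi 0, driftIntegrand α (2 * α - 1) u = 0 := by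
  have hint := integrableOn_driftIntegrand (α := α) (ν := 2 * α - 1) (by linarith) (by linarith) hα1
  have hI0 := hint.mono_set (Ioc_subset_Ioi_self : Ioc (0 : ℝ) 1 ⊆ Ioi 0)
  have hI1 := hint.mono_set (Ioi_subset_Ioi zero_le_one : Ioi (1 : ℝ) ⊆ Ioi 0)
  have hI0' : IntegrableOn (fun s : ℝ => ((1 - s) ^ (2 * α - 1) - 1) * s ^ (-1 - α)) (Ioo 0 1) := by
    refine (hI0.mono_set Ioo_subset_Ioc_self).congr_fun (fun s hs => ?_) measurableSet_Ioo
    simp only [driftIntegrand]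
    rw [abs_of_nonneg (by linarith [hs.2])]
  have hpow : IntegrableOn (fun u : ℝ => u ^ (-1 - α)) (Ioi 1) :=
    integrableOn_Ioi_rpow_of_lt (by linarith) one_pos
  have hbeta := integrableOn_beta hα hα1
  have h1 : ∫ u in Ioi 1, driftIntegrand α (2 * α - 1) u =
      (∫ s in Ioo (0 : ℝ) 1, (1 - s) ^ (2 * α - 1) * s ^ (-α)) - α⁻¹ := by
    have hcongr : EqOn (fun u : ℝ => (u - 1) ^ (2 * α - 1) * u ^ (-1 - α))
        (fun u => driftIntegrand α (2 * α - 1) u + u ^ (-1 - α)) (Ioi 1) := by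
      intro u hu
      have hu1 : (1 : ℝ) < u := hu
      simp only [driftIntegrand]
      rw [abs_sub_comm, abs_of_nonneg (by linarith)]
      ring
    have h2 : ∫ u in Ioi (1 : ℝ), u ^ (-1 - α) = α⁻¹ := by
      rw [integral_Ioi_rpow_of_lt (by linarith) one_pos, Real.one_rpow]
      ring_nf
    rw [← integral_sub_one_rpow, setIntegral_congr_fun measurableSet_Ioi hcongr,
      integral_add hI1 hpow, h2]
    ring
  have h0 : ∫ u in Ioc 0 1, driftIntegrand α (2 * α - 1) u =
      ∫ s in Ioo (0 : ℝ) 1, ((1 - s) ^ (2 * α - 1) - 1) * s ^ (-1 - α) := by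
    rw [integral_Ioc_eq_integral_Ioo]
    refine setIntegral_congr_fun measurableSet_Ioo fun s hs => ?_
    simp only [driftIntegrand]
    rw [abs_of_nonneg (by linarith [hs.2])]
  -- The primitive rises from 0 to α⁻¹, which cancels the -α⁻¹ left by the constant term on (1, ∞).
  have hG : ∫ s in Ioo (0 : ℝ) 1, ((1 - s) ^ (2 * α - 1) * s ^ (-α) +
      ((1 - s) ^ (2 * α - 1) - 1) * s ^ (-1 - α)) = α⁻¹ := by
    rw [← integral_Ioc_eq_integral_Ioo, ← intervalIntegral.integral_of_le zero_le_one]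
    have h01 : ∀ s ∈ Ioo (0 : ℝ) 1, (1 - s) ^ (2 * α) ≤ 1 ∧ 1 - 2 * α * s ≤ (1 - s) ^ (2 * α) := by
      intro s hs
      refine ⟨Real.rpow_le_one (by linarith [hs.2]) (by linarith [hs.1]) (by linarith), ?_⟩
      have := one_add_mul_self_le_rpow_one_add (s := -s) (by linarith [hs.2])
        (p := 2 * α) (by linarith)
      rw [← sub_eq_add_neg] at this
      linarith
    have hT1 : Tendsto (fun s : ℝ => α⁻¹ * (s ^ (-α) * (1 - (1 - s) ^ (2 * α)))) (𝓝[<] 1)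
        (𝓝 α⁻¹) := by
      have hc : ContinuousAt (fun s : ℝ => α⁻¹ * (s ^ (-α) * (1 - (1 - s) ^ (2 * α)))) 1 := by
        refine continuousAt_const.mul ((Real.continuousAt_rpow_const _ _ (by simp)).mul
          (continuousAt_const.sub ?_))
        exact (continuousAt_const.sub continuousAt_id).rpow_const (Or.inr (by linarith))
      have := hc.tendsto
      rw [sub_self, Real.zero_rpow (by linarith), Real.one_rpow] at this
      simpa using this.mono_left nhdsWithin_le_nhds
    -- Bernoulli's inequality with exponent 2α ≥ 1 bounds the primitive by 2 s ^ (1 - α).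
    have hT0 : Tendsto (fun s : ℝ => α⁻¹ * (s ^ (-α) * (1 - (1 - s) ^ (2 * α)))) (𝓝[>] 0)
        (𝓝 0) := by
      have hu : Tendsto (fun s : ℝ => 2 * s ^ (1 - α)) (𝓝[>] 0) (𝓝 0) := by
        have hc : ContinuousAt (fun s : ℝ => 2 * s ^ (1 - α)) 0 :=
          continuousAt_const.mul (Real.continuousAt_rpow_const _ _ (Or.inr (by linarith)))
        have := hc.tendsto
        rw [Real.zero_rpow (by linarith), mul_zero] at this
        exact this.mono_left nhdsWithin_le_nhds
      have hmem : Ioo (0 : ℝ) 1 ∈ 𝓝[>] (0 : ℝ) := Ioo_mem_nhdsGT one_pos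
      refine tendsto_of_tendsto_of_tendsto_of_le_of_le' tendsto_const_nhds hu ?_ ?_
      · filter_upwards [hmem] with s hs
        have := (h01 s hs).1
        have h0 : 0 < s := hs.1
        have h2 : 0 ≤ 1 - (1 - s) ^ (2 * α) := by linarith
        have h3 : 0 < α := by linarith
        positivity
      · filter_upwards [hmem] with s hs
        have h0 : 0 < s := hs.1
        have hα0 : 0 < α := by linarith
        have h2 : s ^ (1 - α) = s ^ (-α) * s := by
          rw [← Real.rpow_add_one h0.ne']
          ring_nf
        calc α⁻¹ * (s ^ (-α) * (1 - (1 - s) ^ (2 * α)))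
            ≤ α⁻¹ * (s ^ (-α) * (2 * α * s)) := by
              gcongr
              linarith [(h01 s hs).2]
          _ = 2 * s ^ (1 - α) := by
              rw [h2]
              field_simp
    rw [intervalIntegral.integral_eq_sub_of_hasDerivAt_of_tendsto one_pos
      (fun s hs => hasDerivAt_driftPrimitive (by linarith) hs.1 hs.2) ?_ hT0 hT1, sub_zero]
    rw [intervalIntegrable_iff_integrableOn_Ioc_of_le zero_le_one, integrableOn_Ioc_iff_integrableOn_Ioo]
    exact hbeta.add hI0'
  rw [integral_add hbeta hI0'] at hG
  rw [← Ioc_union_Ioi_eq_Ioi (zero_le_one' ℝ), setIntegral_union Ioc_disjoint_Ioi_same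
    measurableSet_Ioi hI0 hI1, h0, h1]
  linarith

/-- A power of `r` is a strictly convex function of the exponent. -/
lemma rpow_mul_lt_convex {θ β r : ℝ} (hθ0 : 0 < θ) (hθ1 : θ < 1) (hβ : 0 < β) (hr0 : 0 ≤ r)
    (hr1 : r ≠ 1) : r ^ (θ * β) - 1 < θ * (r ^ β - 1) := by
  have hne : r ^ β - 1 ≠ 0 := by
    intro h
    rw [sub_eq_zero, ← Real.one_rpow β, Real.rpow_left_inj hr0 zero_le_one hβ.ne'] at h
    exact hr1 h
  have h := rpow_one_add_lt_one_add_mul_self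
    (s := r ^ β - 1) (by linarith [Real.rpow_nonneg hr0 β]) hne hθ0 hθ1
  rw [add_sub_cancel, ← Real.rpow_mul hr0, mul_comm β] at h
  linarith

/-- Convexity is applied with r = |1 - u|. For u > 0 the exceptional value r = 1 occurs only at u =
2, a null set. -/
lemma integral_driftIntegrand_lt {α θ β : ℝ} (hα1 : α < 1) (hθ0 : 0 < θ) (hθ1 : θ < 1)
    (hβ : 0 < β) (hβα : β < α) :
    ∫ u in Ioi 0, driftIntegrand α (θ * β) u < θ * ∫ u in Ioi 0, driftIntegrand α β u := by
  have h1 := integrableOn_driftIntegrand (α := α) (ν := θ * β) (by positivity)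
    (by nlinarith) hα1
  have h2 := (integrableOn_driftIntegrand hβ.le hβα hα1).const_mul θ
  rw [← integral_const_mul, ← sub_pos, ← integral_sub h2 h1]
  have hle : ∀ u : ℝ, 0 < u → u ≠ 2 →
      0 < θ * driftIntegrand α β u - driftIntegrand α (θ * β) u := by
    intro u hu hu2
    have hne : |1 - u| ≠ 1 := by
      intro h
      rcases abs_eq (zero_le_one' ℝ) |>.1 h with h | h
      · linarith
      · exact hu2 (by linarith)
    have h := rpow_mul_lt_convex hθ0 hθ1 hβ (abs_nonneg (1 - u)) hne
    have h3 : 0 < u ^ (-1 - α) := by positivity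
    simp only [driftIntegrand]
    nlinarith
  have hne2 : ∀ᵐ u : ℝ, u ≠ 2 := by
    simp [ae_iff]
  refine (integral_pos_iff_support_of_nonneg_ae ?_ (h2.sub h1)).2 ?_
  swap
  · have hsub : Ioo (0 : ℝ) 1 ⊆
        Function.support (fun u => θ * driftIntegrand α β u - driftIntegrand α (θ * β) u) ∩ Ioi 0 :=
      fun u hu => ⟨(hle u hu.1 (by linarith [hu.2])).ne', hu.1⟩
    rw [Measure.restrict_apply' measurableSet_Ioi]
    refine lt_of_lt_of_le ?_ (measure_mono hsub)
    simp
  · refine (ae_restrict_iff' measurableSet_Ioi).2 ?_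
    filter_upwards [hne2] with u hu2 hu
    exact (hle u hu hu2).le

/-- Here ν = θ (2α - 1) is compared with the zero at 2α - 1; for the positive sign the roles are
exchanged and 2α - 1 = θ ν. -/
lemma integral_driftIntegrand_neg {α ν : ℝ} (hα1 : α < 1) (hν : 0 < ν) (hνα : ν < 2 * α - 1) :
    ∫ u in Ioi 0, driftIntegrand α ν u < 0 := by
  have hβ : 0 < 2 * α - 1 := by linarith
  have h := integral_driftIntegrand_lt (α := α) (θ := ν / (2 * α - 1)) (β := 2 * α - 1) hα1
    (by positivity) ((div_lt_one hβ).2 hνα) hβ (by linarith)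
  rwa [integral_driftIntegrand_eq_zero (by linarith) hα1, mul_zero, div_mul_cancel₀ _ hβ.ne'] at h

lemma integral_driftIntegrand_pos {α ν : ℝ} (hα : 1 / 2 < α) (hα1 : α < 1) (hν : 2 * α - 1 < ν)
    (hνα : ν < α) : 0 < ∫ u in Ioi 0, driftIntegrand α ν u := by
  have hβ : 0 < 2 * α - 1 := by linarith
  have hν0 : 0 < ν := by linarith
  have h := integral_driftIntegrand_lt (α := α) (θ := (2 * α - 1) / ν) (β := ν) hα1
    (by positivity) ((div_lt_one hν0).2 hν) hν0 hνα
  rw [div_mul_cancel₀ _ hν0.ne', integral_driftIntegrand_eq_zero hα hα1] at h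
  exact pos_of_mul_pos_right h (by positivity)

/-! ### Survival probabilities of a Markov chain -/

/-- The event that the process `Z` stays outside `[-a, a]` up to time `n`. -/
def survivalSet {Ω : Type*} (Z : ℕ → Ω → ℝ) (a : ℝ) (n : ℕ) : Set Ω :=
  {ω | ∀ k ≤ n, a < |Z k ω|}

section Passage

variable {Ω : Type*} {Z : ℕ → Ω → ℝ} {a : ℝ}

lemma lt_passageTime_iff {n : ℕ} {ω : Ω} :
    (n : ℕ∞) < passageTime Z a ω ↔ ω ∈ survivalSet Z a n := by
  have h := hittingAfter_le_iff (u := Z) (s := {z | |z| ≤ a}) (n := 0) (i := n) (ω := ω)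
  rw [survivalSet, mem_ofPred_eq, ← not_le]
  unfold passageTime
  refine (not_congr h).trans ?_
  simp

lemma survivalSet_succ (n : ℕ) :
    survivalSet Z a (n + 1) = survivalSet Z a n ∩ Z (n + 1) ⁻¹' {z | a < |z|} := by
  ext ω
  simp only [survivalSet, mem_ofPred_eq, mem_inter_iff, mem_preimage]
  refine ⟨fun h => ⟨fun k hk => h k (by omega), h _ le_rfl⟩, fun h k hk => ?_⟩
  rcases Nat.le_succ_iff.1 hk with hk | rfl
  · exact h.1 k hk
  · exact h.2

end Passage

lemma measurableSet_lt_abs (a : ℝ) : MeasurableSet {z : ℝ | a < |z|} :=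
  measurableSet_lt measurable_const (by fun_prop)

namespace IsMarkovChainFrom

variable {Ω : Type*} {m : MeasurableSpace Ω} {P : Measure Ω}
  {ℱ : Filtration ℕ m} {κ : Kernel ℝ ℝ} {x : ℝ} {Z : ℕ → Ω → ℝ} {a : ℝ}

lemma measurable (hZ : IsMarkovChainFrom P ℱ κ x Z) (n : ℕ) : Measurable (Z n) :=
  (hZ.adapted n).mono (ℱ.le n) le_rfl

lemma measurableSet_survivalSet (hZ : IsMarkovChainFrom P ℱ κ x Z) (n : ℕ) :
    MeasurableSet[ℱ n] (survivalSet Z a n) := by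
  have h : survivalSet Z a n = ⋂ k ∈ Iic n, Z k ⁻¹' {z | a < |z|} := by
    ext ω
    simp [survivalSet]
  rw [h]
  refine MeasurableSet.biInter (to_countable _) fun k hk => ?_
  exact ((hZ.adapted k).mono (ℱ.mono hk) le_rfl) (measurableSet_lt_abs a)

lemma one_le_passageTime (hZ : IsMarkovChainFrom P ℱ κ x Z) (hx : a < |x|) :
    ∀ᵐ ω ∂P, 1 ≤ passageTime Z a ω := by
  filter_upwards [hZ.start] with ω hω
  have h : ((0 : ℕ) : ℕ∞) < passageTime Z a ω := by
    rw [lt_passageTime_iff]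
    intro k hk
    rw [Nat.le_zero.1 hk, hω]
    exact hx
  exact Order.one_le_iff_pos.2 h

lemma measurableSet_lt_passageTime (hZ : IsMarkovChainFrom P ℱ κ x Z) (n : ℕ) :
    MeasurableSet {ω | (n : ℕ∞) < passageTime Z a ω} := by
  have hset : {ω | (n : ℕ∞) < passageTime Z a ω} = survivalSet Z a n :=
    ext fun ω => lt_passageTime_iff
  rw [hset]
  exact ℱ.le n _ (hZ.measurableSet_survivalSet n)

/-! ### From tail bounds to moments -/

/-- A single dyadic level suffices: j = log₂ (t - 1) satisfies 2 ^ j < t ≤ 2 ^ (j + 1). The shift by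
one matches the strict inequality in the indicator, and the summand 1 covers t ≤ 1. -/
lemma rpow_le_tsum {t : ℕ∞} (ht : t ≠ ⊤) {p : ℝ} (hp : 0 < p) :
    (t : ℝ≥0∞) ^ p ≤ 1 + ∑' j : ℕ,
      {s : ℕ∞ | ((2 ^ j : ℕ) : ℕ∞) < s}.indicator (fun _ => ((2 ^ (j + 1) : ℕ) : ℝ≥0∞) ^ p) t := by
  lift t to ℕ using ht
  rw [ENat.toENNReal_coe]
  rcases le_or_gt t 1 with h | h
  · refine le_trans ?_ le_self_add
    exact ENNReal.rpow_le_one (by exact_mod_cast h) hp.le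
  · refine le_trans ?_ le_add_self
    refine le_trans ?_ (ENNReal.le_tsum (Nat.log 2 (t - 1)))
    have h1 : 2 ^ Nat.log 2 (t - 1) < t := by
      have := Nat.pow_log_le_self 2 (x := t - 1) (by omega)
      omega
    have h2 : t ≤ 2 ^ (Nat.log 2 (t - 1) + 1) := by
      have := Nat.lt_pow_succ_log_self (b := 2) one_lt_two (t - 1)
      rw [Nat.succ_eq_add_one] at this
      omega
    rw [indicator_of_mem (by rw [mem_ofPred_eq]; exact_mod_cast h1)]
    exact ENNReal.rpow_le_rpow (by exact_mod_cast h2) hp.le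

/-- Markov's inequality: E[τ ^ p] ≥ N ^ p P(τ > N) ≥ c N ^ (p - q), which is unbounded in N. -/
lemma passageMoment_eq_top (hZ : IsMarkovChainFrom P ℱ κ x Z) {q c : ℝ} (hq : 0 ≤ q) (hc : 0 < c)
    (hC : ∀ᶠ N : ℕ in atTop,
      ENNReal.ofReal (c * (N : ℝ) ^ (-q)) ≤ P {ω | (N : ℕ∞) < passageTime Z a ω})
    {p : ℝ} (hp : q < p) : passageMoment P Z a p = ⊤ := by
  have hp0 : 0 < p := by linarith
  have htend : Tendsto (fun N : ℕ => ENNReal.ofReal (c * (N : ℝ) ^ (p - q))) atTop (𝓝 ⊤) := by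
    refine ENNReal.tendsto_ofReal_atTop.comp ?_
    exact ((tendsto_rpow_atTop (by linarith)).comp tendsto_natCast_atTop_atTop).const_mul_atTop hc
  rw [← top_le_iff]
  refine le_of_tendsto htend ?_
  filter_upwards [hC, eventually_gt_atTop 0] with N hN hN0
  have hN0' : (0 : ℝ) < N := by exact_mod_cast hN0
  have h1 : ENNReal.ofReal (c * (N : ℝ) ^ (p - q)) =
      (N : ℝ≥0∞) ^ p * ENNReal.ofReal (c * (N : ℝ) ^ (-q)) := by
    rw [← ENNReal.ofReal_natCast N, ENNReal.ofReal_rpow_of_pos hN0',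
      ← ENNReal.ofReal_mul (by positivity), sub_eq_add_neg, Real.rpow_add hN0']
    ring_nf
  rw [h1]
  calc _ ≤ (N : ℝ≥0∞) ^ p * P {ω | (N : ℕ∞) < passageTime Z a ω} := by gcongr
    _ = ∫⁻ _ω in {ω | (N : ℕ∞) < passageTime Z a ω}, (N : ℝ≥0∞) ^ p ∂P := by
      rw [setLIntegral_const]
    _ ≤ ∫⁻ ω in {ω | (N : ℕ∞) < passageTime Z a ω}, (passageTime Z a ω : ℝ≥0∞) ^ p ∂P := by
      refine setLIntegral_mono' (hZ.measurableSet_lt_passageTime N) fun ω hω => ?_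
      refine ENNReal.rpow_le_rpow ?_ hp0.le
      rw [← ENat.toENNReal_coe]
      exact ENat.toENNReal_mono (le_of_lt hω)
    _ ≤ _ := setLIntegral_le_lintegral _ _

variable [IsProbabilityMeasure P]

/-- The dyadic terms 2 ^ ((j + 1) p) P(τ > 2 ^ j) are dominated by a geometric series of ratio 2 ^
(p - q). -/
lemma passageMoment_lt_top (hZ : IsMarkovChainFrom P ℱ κ x Z) (hx : a < |x|) {q C : ℝ}
    (hq : 0 < q) (hC : ∀ N : ℕ, 1 ≤ N →
      P {ω | (N : ℕ∞) < passageTime Z a ω} ≤ ENNReal.ofReal (C * (N : ℝ) ^ (-q)))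
    {p : ℝ} (hp : p < q) : passageMoment P Z a p < ⊤ := by
  -- Since τ ≥ 1 almost surely, the moment increases with the exponent, so p ≤ 0 reduces to q / 2.
  wlog hp0 : 0 < p generalizing p
  · refine lt_of_le_of_lt ?_ (this (p := q / 2) (by linarith) (by linarith))
    refine lintegral_mono_ae ?_
    filter_upwards [hZ.one_le_passageTime hx] with ω hω
    exact ENNReal.rpow_le_rpow_of_exponent_le
      (by exact_mod_cast ENat.toENNReal_mono hω) (by linarith)
  have hfin : ∀ᵐ ω ∂P, passageTime Z a ω ≠ ⊤ := by
    have htend : Tendsto (fun N : ℕ => ENNReal.ofReal (C * (N : ℝ) ^ (-q))) atTop (𝓝 0) := by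
      have h := ((tendsto_rpow_neg_atTop hq).comp tendsto_natCast_atTop_atTop).const_mul C
      rw [mul_zero] at h
      simpa using ENNReal.tendsto_ofReal h
    rw [ae_iff, ← nonpos_iff_eq_zero]
    refine ge_of_tendsto htend ?_
    filter_upwards [eventually_ge_atTop 1] with N hN
    refine le_trans (measure_mono fun ω hω => ?_) (hC N hN)
    have h : passageTime Z a ω = ⊤ := not_not.1 hω
    rw [mem_ofPred_eq, h]
    exact ENat.natCast_lt_top N
  have hbound : passageMoment P Z a p ≤ ∫⁻ ω, (1 + ∑' j : ℕ,
      {ω | ((2 ^ j : ℕ) : ℕ∞) < passageTime Z a ω}.indicator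
        (fun _ => ((2 ^ (j + 1) : ℕ) : ℝ≥0∞) ^ p) ω) ∂P :=
    lintegral_mono_ae (hfin.mono fun ω hω => rpow_le_tsum hω hp0)
  refine lt_of_le_of_lt hbound ?_
  rw [lintegral_add_left measurable_const, lintegral_tsum
    fun j => (measurable_const.indicator (hZ.measurableSet_lt_passageTime _)).aemeasurable]
  simp_rw [lintegral_indicator_const (hZ.measurableSet_lt_passageTime _)]
  refine ENNReal.add_lt_top.2 ⟨by simp, ?_⟩
  set ρ : ℝ := (2 : ℝ) ^ (p - q) with hρ
  have hρ1 : ρ < 1 := Real.rpow_lt_one_of_one_lt_of_neg one_lt_two (by linarith)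
  have hρ0 : 0 < ρ := by positivity
  have hle : ∀ j : ℕ, ((2 ^ (j + 1) : ℕ) : ℝ≥0∞) ^ p *
      P {ω | ((2 ^ j : ℕ) : ℕ∞) < passageTime Z a ω} ≤
      ENNReal.ofReal (2 ^ p * |C| * ρ ^ j) := by
    intro j
    have h1 : ((2 ^ (j + 1) : ℕ) : ℝ≥0∞) ^ p = ENNReal.ofReal ((2 ^ (j + 1) : ℝ) ^ p) := by
      rw [← ENNReal.ofReal_rpow_of_pos (by positivity), ENNReal.ofReal_pow (by norm_num)]
      simp
    refine le_trans (mul_le_mul_right (hC (2 ^ j) Nat.one_le_two_pow) _) ?_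
    rw [h1, ← ENNReal.ofReal_mul (by positivity)]
    refine ENNReal.ofReal_le_ofReal ?_
    have h2 : ((2 ^ j : ℕ) : ℝ) ^ (-q) = (2 : ℝ) ^ (-q * j) := by
      push_cast
      rw [← Real.rpow_natCast, ← Real.rpow_mul (by norm_num)]
      ring_nf
    have h3 : ((2 : ℝ) ^ (j + 1)) ^ p = 2 ^ p * (2 : ℝ) ^ (p * j) := by
      rw [← Real.rpow_natCast, ← Real.rpow_mul (by norm_num), ← Real.rpow_add (by norm_num)]
      push_cast
      ring_nf
    have h4 : ρ ^ j = (2 : ℝ) ^ (p * j) * (2 : ℝ) ^ (-q * j) := by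
      rw [hρ, ← Real.rpow_natCast, ← Real.rpow_mul (by norm_num), ← Real.rpow_add (by norm_num)]
      ring_nf
    rw [h2, h3, h4]
    calc _ = 2 ^ p * C * ((2 : ℝ) ^ (p * j) * (2 : ℝ) ^ (-q * j)) := by ring
      _ ≤ _ := by
        gcongr
        exact le_abs_self C
  refine lt_of_le_of_lt (ENNReal.tsum_le_tsum hle) ?_
  have hs : Summable fun j : ℕ => 2 ^ p * |C| * ρ ^ j :=
    (summable_geometric_of_lt_one hρ0.le hρ1).mul_left _
  rw [← ENNReal.ofReal_tsum_of_nonneg (fun j => by positivity) hs]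
  exact ENNReal.ofReal_lt_top

/-! ### One-step recursion -/

variable [IsMarkovKernel κ]

/-- The Markov property integrated over an event of the past. As an identity of measures it passes
from sets to nonnegative functions at once. -/
lemma map_restrict_succ (hZ : IsMarkovChainFrom P ℱ κ x Z) {n : ℕ} {S : Set Ω}
    (hS : MeasurableSet[ℱ n] S) :
    (P.restrict S).map (Z (n + 1)) = ((P.restrict S).map (Z n)).bind κ := by
  have hSm := ℱ.le n _ hS
  ext B hB
  rw [Measure.map_apply (hZ.measurable _) hB, Measure.bind_apply hB κ.measurable.aemeasurable,
    lintegral_map (κ.measurable_coe hB) (hZ.measurable _)]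
  have hmeas : MeasurableSet (Z (n + 1) ⁻¹' B) := hZ.measurable _ hB
  have h1 : ∫ ω in S, (P⟦Z (n + 1) ⁻¹' B | ℱ n⟧) ω ∂P =
      ∫ ω in S, (Z (n + 1) ⁻¹' B).indicator (fun _ => (1 : ℝ)) ω ∂P :=
    setIntegral_condExp (ℱ.le n) ((integrable_const _).indicator hmeas) hS
  rw [integral_congr_ae (ae_restrict_of_ae (hZ.step n B hB)), integral_indicator hmeas,
    integral_const, smul_eq_mul, mul_one, measureReal_restrict_apply_univ] at h1
  have hκm : Measurable fun ω => κ (Z n ω) B := (κ.measurable_coe hB).comp (hZ.measurable n)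
  have h2 : ∫ ω in S, (κ (Z n ω)).real B ∂P = (∫⁻ ω in S, κ (Z n ω) B ∂P).toReal :=
    integral_toReal hκm.aemeasurable (Eventually.of_forall fun ω => measure_lt_top _ _)
  rw [h2, measureReal_def] at h1
  refine ((ENNReal.toReal_eq_toReal_iff' ?_ (measure_ne_top _ _)).1 h1).symm
  have h3 : ∫⁻ ω in S, κ (Z n ω) B ∂P ≤ ∫⁻ _ω in S, 1 ∂P :=
    lintegral_mono fun ω => prob_le_one
  refine ne_top_of_le_ne_top ?_ h3
  simp

lemma setLIntegral_succ (hZ : IsMarkovChainFrom P ℱ κ x Z) {n : ℕ} {S : Set Ω}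
    (hS : MeasurableSet[ℱ n] S) {g : ℝ → ℝ≥0∞} (hg : Measurable g) :
    ∫⁻ ω in S, g (Z (n + 1) ω) ∂P = ∫⁻ ω in S, ∫⁻ z, g z ∂κ (Z n ω) ∂P := by
  rw [← lintegral_map hg (hZ.measurable _), hZ.map_restrict_succ hS,
    Measure.lintegral_bind κ.measurable.aemeasurable hg.aemeasurable,
    lintegral_map hg.lintegral_kernel (hZ.measurable _)]

lemma setLIntegral_survivalSet_succ (hZ : IsMarkovChainFrom P ℱ κ x Z) (n : ℕ)
    {g : ℝ → ℝ≥0∞} (hg : Measurable g) :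
    ∫⁻ ω in survivalSet Z a (n + 1), g (Z (n + 1) ω) ∂P =
      ∫⁻ ω in survivalSet Z a n, ∫⁻ z in {z | a < |z|}, g z ∂κ (Z n ω) ∂P := by
  have hU := measurableSet_lt_abs a
  have h := hZ.setLIntegral_succ (hZ.measurableSet_survivalSet (a := a) n) (hg.indicator hU)
  simp_rw [lintegral_indicator hU] at h
  rw [← h, survivalSet_succ, inter_comm, ← setLIntegral_indicator (hZ.measurable _ hU)]
  rfl

/-- The expectation of V k (Z k) on survival up to time k does not increase with k. It starts at V 0
x at most and ends above the survival probability. -/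
lemma measure_lt_passageTime_le (hZ : IsMarkovChainFrom P ℱ κ x Z)
    {V : ℕ → ℝ → ℝ≥0∞} (hV : ∀ k, Measurable (V k)) {N : ℕ}
    (hstep : ∀ k < N, ∀ y, a < |y| → ∫⁻ z in {z | a < |z|}, V (k + 1) z ∂κ y ≤ V k y)
    (hN : ∀ y, a < |y| → 1 ≤ V N y) :
    P {ω | (N : ℕ∞) < passageTime Z a ω} ≤ V 0 x := by
  have hm : ∀ n, MeasurableSet (survivalSet Z a n) := fun n =>
    ℱ.le n _ (hZ.measurableSet_survivalSet n)
  have hmono : ∀ k ≤ N, ∫⁻ ω in survivalSet Z a k, V k (Z k ω) ∂P ≤ V 0 x := by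
    intro k
    induction k with
    | zero =>
      intro _
      calc _ ≤ ∫⁻ ω, V 0 (Z 0 ω) ∂P := setLIntegral_le_lintegral _ _
        _ = ∫⁻ _ω, V 0 x ∂P := lintegral_congr_ae (hZ.start.mono fun ω h => by simp only [h])
        _ = V 0 x := by simp
    | succ k ih =>
      intro hk
      rw [hZ.setLIntegral_survivalSet_succ k (hV _)]
      refine le_trans (setLIntegral_mono ((hV k).comp (hZ.measurable k)) fun ω hω => ?_)
        (ih (by omega))
      exact hstep k (by omega) _ (hω k le_rfl)
  have hset : {ω | (N : ℕ∞) < passageTime Z a ω} = survivalSet Z a N :=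
    ext fun ω => lt_passageTime_iff
  rw [hset]
  refine le_trans ?_ (hmono N le_rfl)
  rw [← setLIntegral_one]
  exact setLIntegral_mono ((hV N).comp (hZ.measurable N)) fun ω hω => hN _ (hω N le_rfl)

/-- The same monotonicity with the inequalities reversed; now survival at time 0 has to be known. -/
lemma le_measure_lt_passageTime (hZ : IsMarkovChainFrom P ℱ κ x Z) (hx : a < |x|)
    {V : ℕ → ℝ → ℝ≥0∞} (hV : ∀ k, Measurable (V k)) {N : ℕ}
    (hstep : ∀ k < N, ∀ y, a < |y| → V k y ≤ ∫⁻ z in {z | a < |z|}, V (k + 1) z ∂κ y)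
    (hN : ∀ y, V N y ≤ 1) :
    V 0 x ≤ P {ω | (N : ℕ∞) < passageTime Z a ω} := by
  have hmono : ∀ k ≤ N, V 0 x ≤ ∫⁻ ω in survivalSet Z a k, V k (Z k ω) ∂P := by
    intro k
    induction k with
    | zero =>
      intro _
      have h0 : survivalSet Z a 0 =ᵐ[P] (univ : Set Ω) := by
        rw [ae_eq_univ_iff_measure_eq (ℱ.le 0 _ (hZ.measurableSet_survivalSet 0)).nullMeasurableSet]
        refine measure_congr ?_
        filter_upwards [hZ.start] with ω hω
        refine eq_true ?_ |>.trans (eq_true trivial).symm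
        intro k hk
        rw [Nat.le_zero.1 hk, hω]
        exact hx
      rw [Measure.restrict_congr_set h0, Measure.restrict_univ,
        lintegral_congr_ae (hZ.start.mono fun ω h => by simp only [h] :
          (fun ω => V 0 (Z 0 ω)) =ᵐ[P] fun _ => V 0 x)]
      simp
    | succ k ih =>
      intro hk
      rw [hZ.setLIntegral_survivalSet_succ k (hV _)]
      refine le_trans (ih (by omega)) ?_
      have hmeas : Measurable fun ω => ∫⁻ z in {z | a < |z|}, V (k + 1) z ∂κ (Z k ω) :=
        ((hV _).setLIntegral_kernel (measurableSet_lt_abs a)).comp (hZ.measurable k)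
      exact setLIntegral_mono hmeas fun ω hω => hstep k (by omega) _ (hω k le_rfl)
  have hset : {ω | (N : ℕ∞) < passageTime Z a ω} = survivalSet Z a N :=
    ext fun ω => lt_passageTime_iff
  rw [hset]
  refine le_trans (hmono N le_rfl) ?_
  rw [← setLIntegral_one]
  exact lintegral_mono fun ω => hN _

end IsMarkovChainFrom

/-! ### Tail bounds from a Lyapunov function -/

namespace IsMarkovChainFrom

variable {Ω : Type*} {m : MeasurableSpace Ω} {P : Measure Ω} [IsProbabilityMeasure P]
  {ℱ : Filtration ℕ m} {κ : Kernel ℝ ℝ} [IsMarkovKernel κ] {x : ℝ} {Z : ℕ → Ω → ℝ} {a : ℝ}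

/-- A Lyapunov function `h ^ q`, `q ≤ 1`, with drift `-c h ^ (q - 1)` gives a polynomial tail of
exponent `q` for the passage time. -/
lemma exists_tail_le_of_le_one (hZ : IsMarkovChainFrom P ℱ κ x Z) (hx : a < |x|) {q c : ℝ}
    (hq0 : 0 < q) (hq1 : q ≤ 1) (hc : 0 < c) {h : ℝ → ℝ} (hm : Measurable h)
    (hpos : ∀ y, a < |y| → 0 < h y)
    (hdrift : ∀ y, a < |y| → ∫⁻ z in {z | a < |z|}, ENNReal.ofReal (h z ^ q) ∂κ y +
      ENNReal.ofReal (c * h y ^ (q - 1)) ≤ ENNReal.ofReal (h y ^ q)) :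
    ∃ C : ℝ, ∀ N : ℕ, 1 ≤ N →
      P {ω | (N : ℕ∞) < passageTime Z a ω} ≤ ENNReal.ofReal (C * (N : ℝ) ^ (-q)) := by
  -- A ≥ 1 makes the function V below reach its cap where h ≥ N, and A c ≥ 1 makes the drift pay for
  -- the passage of time where h < N.
  set A : ℝ := max 1 c⁻¹ with hA
  have hA1 : 1 ≤ A := le_max_left _ _
  have hAc : 1 ≤ A * c := by
    have : c⁻¹ * c ≤ A * c := by gcongr; exact le_max_right _ _
    rwa [inv_mul_cancel₀ hc.ne'] at this
  refine ⟨A * h x ^ q, fun N hN => ?_⟩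
  have hN0 : (0 : ℝ) < N := by exact_mod_cast hN
  set D : ℝ≥0∞ := ENNReal.ofReal (A * (N : ℝ) ^ (-q)) with hD
  -- The term k / N brings V up to 1 at time N and costs 1 / N per step. Where h < N, the condition
  -- q ≤ 1 gives h ^ (q - 1) ≥ N ^ (q - 1), so the drift weighted by D is at least 1 / N.
  set V : ℕ → ℝ → ℝ≥0∞ := fun k y =>
    min 1 (D * ENNReal.ofReal (h y ^ q) + ENNReal.ofReal (k / N)) with hV
  have hVm : ∀ k, Measurable (V k) := fun k => by
    refine measurable_const.min ((Measurable.const_mul ?_ _).add_const _)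
    exact (hm.pow_const q).ennreal_ofReal
  refine le_trans (hZ.measure_lt_passageTime_le hVm (N := N) ?_ ?_) ?_
  · intro k _ y hy
    have hle1 : ∫⁻ z in {z | a < |z|}, V (k + 1) z ∂κ y ≤ 1 := by
      calc _ ≤ ∫⁻ _z in {z | a < |z|}, 1 ∂κ y := lintegral_mono fun z => min_le_left _ _
        _ = κ y {z | a < |z|} := setLIntegral_one _
        _ ≤ 1 := prob_le_one
    refine le_min hle1 ?_
    have hy0 := hpos y hy
    rcases le_or_gt (N : ℝ) (h y) with hNh | hNh
    · refine hle1.trans (le_trans ?_ le_self_add)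
      rw [hD, ← ENNReal.ofReal_mul (by positivity), ENNReal.one_le_ofReal]
      have h1 : (N : ℝ) ^ q ≤ h y ^ q := Real.rpow_le_rpow hN0.le hNh hq0.le
      have h2 : (N : ℝ) ^ (-q) * (N : ℝ) ^ q = 1 := by
        rw [← Real.rpow_add hN0]
        simp
      calc (1 : ℝ) = 1 * ((N : ℝ) ^ (-q) * (N : ℝ) ^ q) := by rw [h2, one_mul]
        _ ≤ A * ((N : ℝ) ^ (-q) * h y ^ q) := by gcongr
        _ = _ := by ring
    · have h1 : ENNReal.ofReal (1 / N) ≤ D * ENNReal.ofReal (c * h y ^ (q - 1)) := by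
        rw [hD, ← ENNReal.ofReal_mul (by positivity)]
        refine ENNReal.ofReal_le_ofReal ?_
        have h1 : (N : ℝ) ^ (q - 1) ≤ h y ^ (q - 1) :=
          Real.rpow_le_rpow_of_nonpos hy0 hNh.le (by linarith)
        have h2 : (N : ℝ) ^ (-q) * (N : ℝ) ^ (q - 1) = 1 / N := by
          rw [← Real.rpow_add hN0, one_div, ← Real.rpow_neg_one]
          ring_nf
        calc 1 / (N : ℝ) = 1 * ((N : ℝ) ^ (-q) * (N : ℝ) ^ (q - 1)) := by rw [h2, one_mul]
          _ ≤ (A * c) * ((N : ℝ) ^ (-q) * h y ^ (q - 1)) := by gcongr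
          _ = _ := by ring
      have hsplit : ENNReal.ofReal (((k + 1 : ℕ) : ℝ) / N) =
          ENNReal.ofReal (1 / N) + ENNReal.ofReal (k / N) := by
        rw [← ENNReal.ofReal_add (by positivity) (by positivity)]
        push_cast
        ring_nf
      calc ∫⁻ z in {z | a < |z|}, V (k + 1) z ∂κ y
          ≤ ∫⁻ z in {z | a < |z|}, (D * ENNReal.ofReal (h z ^ q) +
            ENNReal.ofReal (((k + 1 : ℕ) : ℝ) / N)) ∂κ y :=
            lintegral_mono fun z => min_le_right _ _
        _ = D * ∫⁻ z in {z | a < |z|}, ENNReal.ofReal (h z ^ q) ∂κ y +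
            ENNReal.ofReal (((k + 1 : ℕ) : ℝ) / N) * κ y {z | a < |z|} := by
            rw [lintegral_add_right _ measurable_const, setLIntegral_const,
              lintegral_const_mul _ (hm.pow_const q).ennreal_ofReal]
        _ ≤ D * ∫⁻ z in {z | a < |z|}, ENNReal.ofReal (h z ^ q) ∂κ y +
            (ENNReal.ofReal (1 / N) + ENNReal.ofReal (k / N)) * 1 := by
            rw [hsplit]
            gcongr
            exact prob_le_one
        _ ≤ D * (∫⁻ z in {z | a < |z|}, ENNReal.ofReal (h z ^ q) ∂κ y +
            ENNReal.ofReal (c * h y ^ (q - 1))) + ENNReal.ofReal (k / N) := by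
            rw [mul_one, mul_add, ← add_assoc]
            gcongr
        _ ≤ _ := by
            gcongr
            exact hdrift y hy
  · intro y _
    refine le_min le_rfl (le_trans ?_ le_add_self)
    rw [div_self hN0.ne', ENNReal.ofReal_one]
  · refine (min_le_right _ _).trans ?_
    have := hpos x hx
    rw [hD, ← ENNReal.ofReal_mul (by positivity)]
    simp only [Nat.cast_zero, zero_div, ENNReal.ofReal_zero, add_zero]
    refine ENNReal.ofReal_le_ofReal (le_of_eq ?_)
    ring

/-- (s + t) / (s₀ + t) is a convex combination of s / s₀ and 1. The bound is affine in s ^ q, so a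
drift inequality for s ^ q can be inserted, and it is sharp at s = s₀. -/
lemma add_rpow_le_convex {q s s₀ t : ℝ} (hq : 1 ≤ q) (hs : 0 ≤ s) (hs₀ : 0 < s₀) (ht : 0 ≤ t) :
    (s + t) ^ q ≤ (s₀ + t) ^ q * (s₀ / (s₀ + t) * (s ^ q / s₀ ^ q) + t / (s₀ + t)) := by
  have h0 : 0 < s₀ + t := by linarith
  have hconv := (convexOn_rpow hq).2 (mem_Ici.2 (by positivity : 0 ≤ s / s₀))
    (mem_Ici.2 zero_le_one) (by positivity : 0 ≤ s₀ / (s₀ + t))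
    (by positivity : 0 ≤ t / (s₀ + t))
    (by rw [← add_div, div_self h0.ne'])
  simp only [smul_eq_mul, mul_one, Real.one_rpow] at hconv
  rw [Real.div_rpow hs hs₀.le] at hconv
  have h1 : s + t = (s₀ + t) * (s₀ / (s₀ + t) * (s / s₀) + t / (s₀ + t)) := by
    field_simp
  calc (s + t) ^ q = (s₀ + t) ^ q * (s₀ / (s₀ + t) * (s / s₀) + t / (s₀ + t)) ^ q := by
        rw [← Real.mul_rpow h0.le (by positivity), ← h1]
    _ ≤ _ := by gcongr

/-- A Lyapunov function `h ^ q`, `1 ≤ q`, with drift `-c h ^ (q - 1)` gives a polynomial tail of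
exponent `q` for the passage time. -/
lemma exists_tail_le_of_one_le (hZ : IsMarkovChainFrom P ℱ κ x Z) (hx : a < |x|) {q c : ℝ}
    (hq : 1 ≤ q) (hc : 0 < c) {h : ℝ → ℝ} (hm : Measurable h)
    (hpos : ∀ y, a < |y| → 0 < h y)
    (hdrift : ∀ y, a < |y| → ∫⁻ z in {z | a < |z|}, ENNReal.ofReal (h z ^ q) ∂κ y +
      ENNReal.ofReal (c * h y ^ (q - 1)) ≤ ENNReal.ofReal (h y ^ q)) :
    ∃ C : ℝ, ∀ N : ℕ, 1 ≤ N →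
      P {ω | (N : ℕ∞) < passageTime Z a ω} ≤ ENNReal.ofReal (C * (N : ℝ) ^ (-q)) := by
  -- With q ε = c, the growth of (h + ε k) ^ q in one unit of time is balanced to first order by the
  -- drift; Bernoulli's inequality gives the error the right sign.
  set ε : ℝ := c / q with hε
  have hq0 : 0 < q := by linarith
  have hε0 : 0 < ε := by positivity
  refine ⟨h x ^ q * ε ^ (-q), fun N hN => ?_⟩
  have hN0 : (0 : ℝ) < N := by exact_mod_cast hN
  set V : ℕ → ℝ → ℝ≥0∞ := fun k y =>
    ENNReal.ofReal ((ε * N) ^ (-q)) * ENNReal.ofReal ((h y + ε * k) ^ q) with hV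
  have hVm : ∀ k, Measurable (V k) := fun k =>
    Measurable.const_mul ((hm.add_const _).pow_const q).ennreal_ofReal _
  refine le_trans (hZ.measure_lt_passageTime_le hVm (N := N) ?_ ?_) ?_
  · intro k _ y hy
    simp only [hV]
    rw [lintegral_const_mul _ ((hm.add_const _).pow_const q).ennreal_ofReal]
    gcongr
    have hy0 := hpos y hy
    set t : ℝ := ε * ((k + 1 : ℕ) : ℝ) with ht
    have ht0 : 0 ≤ t := by positivity
    set I := ∫⁻ z in {z | a < |z|}, ENNReal.ofReal (h z ^ q) ∂κ y with hI
    have hd := hdrift y hy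
    rw [← hI] at hd
    have hItop : I ≠ ⊤ := ne_top_of_le_ne_top ENNReal.ofReal_ne_top (le_self_add.trans hd)
    lift I to NNReal using hItop with J
    have hJ : (J : ℝ) + c * h y ^ (q - 1) ≤ h y ^ q := by
      rw [← ENNReal.ofReal_coe_nnreal, ← ENNReal.ofReal_add (by positivity) (by positivity)] at hd
      exact (ENNReal.ofReal_le_ofReal_iff (by positivity)).1 hd
    calc ∫⁻ z in {z | a < |z|}, ENNReal.ofReal ((h z + t) ^ q) ∂κ y
        ≤ ∫⁻ z in {z | a < |z|}, (ENNReal.ofReal ((h y + t) ^ q * (h y / (h y + t)) / h y ^ q) *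
            ENNReal.ofReal (h z ^ q) + ENNReal.ofReal ((h y + t) ^ q * (t / (h y + t)))) ∂κ y := by
          refine setLIntegral_mono' (measurableSet_lt_abs a) fun z hz => ?_
          have hz0 := hpos z hz
          rw [← ENNReal.ofReal_mul (by positivity),
            ← ENNReal.ofReal_add (by positivity) (by positivity)]
          refine ENNReal.ofReal_le_ofReal ((add_rpow_le_convex hq hz0.le hy0 ht0).trans (le_of_eq ?_))
          ring
      _ = ENNReal.ofReal ((h y + t) ^ q * (h y / (h y + t)) / h y ^ q) * J +
            ENNReal.ofReal ((h y + t) ^ q * (t / (h y + t))) * κ y {z | a < |z|} := by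
          rw [lintegral_add_right _ measurable_const, setLIntegral_const,
            lintegral_const_mul _ (hm.pow_const q).ennreal_ofReal, ← hI]
      _ ≤ ENNReal.ofReal ((h y + t) ^ q * (h y / (h y + t)) / h y ^ q) * J +
            ENNReal.ofReal ((h y + t) ^ q * (t / (h y + t))) * 1 := by
          gcongr
          exact prob_le_one
      _ = ENNReal.ofReal ((h y + t) ^ q * (h y / (h y + t)) / h y ^ q * J +
            (h y + t) ^ q * (t / (h y + t))) := by
          rw [← ENNReal.ofReal_coe_nnreal, ← ENNReal.ofReal_mul (by positivity), mul_one,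
            ← ENNReal.ofReal_add (by positivity) (by positivity)]
      _ ≤ ENNReal.ofReal ((h y + ε * k) ^ q) := by
          refine ENNReal.ofReal_le_ofReal ?_
          have hs0 : 0 < h y + t := by positivity
          have hpow : h y ^ (q - 1) = h y ^ q / h y := Real.rpow_sub_one hy0.ne' q
          have hεt : ε ≤ t := by
            rw [ht]
            push_cast
            nlinarith [(Nat.cast_nonneg k : (0 : ℝ) ≤ k)]
          have hB := one_add_mul_self_le_rpow_one_add (s := -(ε / (h y + t))) (by
            rw [neg_le_neg_iff, div_le_one hs0]
            linarith) hq
          have h2 : h y + ε * k = (h y + t) * (1 + -(ε / (h y + t))) := by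
            rw [mul_add, mul_one, mul_neg, mul_div_cancel₀ _ hs0.ne', ht]
            push_cast
            ring
          have h3 : 0 ≤ 1 + -(ε / (h y + t)) := by
            have : ε / (h y + t) ≤ 1 := by
              rw [div_le_one hs0]
              linarith
            linarith
          rw [h2, Real.mul_rpow hs0.le h3]
          calc _ ≤ (h y + t) ^ q * (h y / (h y + t)) / h y ^ q * (h y ^ q - c * h y ^ (q - 1)) +
                (h y + t) ^ q * (t / (h y + t)) := by
                gcongr
                linarith
            _ = (h y + t) ^ q * (1 + q * -(ε / (h y + t))) := by
                rw [hpow, hε]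
                field_simp
                ring
            _ ≤ _ := by gcongr
  · intro y hy
    have := hpos y hy
    simp only [hV]
    rw [← ENNReal.ofReal_mul (by positivity), ENNReal.one_le_ofReal, Real.rpow_neg (by positivity),
      ← div_eq_inv_mul, one_le_div (by positivity)]
    gcongr
    linarith
  · have := hpos x hx
    simp only [hV]
    rw [← ENNReal.ofReal_mul (by positivity)]
    refine ENNReal.ofReal_le_ofReal (le_of_eq ?_)
    rw [Real.mul_rpow hε0.le hN0.le, Nat.cast_zero, mul_zero, add_zero]
    ring

end IsMarkovChainFrom

/-! ### One step of the oscillating walk -/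

namespace IsOscillatingKernel

variable {v₁ v₂ : ℝ → ℝ} {κ : Kernel ℝ ℝ}

lemma eq_map_of_pos (hκ : IsOscillatingKernel (fun y => v₁ (-y)) v₂ κ) {x : ℝ} (hx : 0 < x) :
    κ x = (densityLaw v₁).map fun y => x - y := by
  ext B hB
  have hB' : MeasurableSet ((fun y => x - y) ⁻¹' B) := measurableSet_preimage (by fun_prop) hB
  rw [hκ.pos x hx B hB, Measure.map_apply (by fun_prop) hB, densityLaw, withDensity_apply _ hB',
    ← lintegral_indicator hB, ← lintegral_indicator hB', ← lintegral_sub_left_eq_self _ x]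
  congr 1
  funext y
  by_cases hy : x - y ∈ B
  · rw [indicator_of_mem hy, indicator_of_mem (by exact hy)]
    ring_nf
  · rw [indicator_of_notMem hy, indicator_of_notMem (by exact hy)]

lemma eq_map_of_neg (hκ : IsOscillatingKernel (fun y => v₁ (-y)) v₂ κ) {x : ℝ} (hx : x < 0) :
    κ x = (densityLaw v₂).map fun y => x + y := by
  ext B hB
  have hB' : MeasurableSet ((fun y => x + y) ⁻¹' B) := measurableSet_preimage (by fun_prop) hB
  rw [hκ.neg x hx B hB, Measure.map_apply (by fun_prop) hB, densityLaw, withDensity_apply _ hB',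
    ← lintegral_indicator hB, ← lintegral_indicator hB', ← lintegral_add_left_eq_self _ x]
  congr 1
  funext y
  by_cases hy : x + y ∈ B
  · rw [indicator_of_mem hy, indicator_of_mem (by exact hy)]
    ring_nf
  · rw [indicator_of_notMem hy, indicator_of_notMem (by exact hy)]

/-- A property that holds for the increment laws on both half-lines holds for one step of the
distance from the origin. -/
lemma lintegral_abs_induction (hκ : IsOscillatingKernel (fun y => v₁ (-y)) v₂ κ) {x : ℝ}
    (hx : x ≠ 0) {g : ℝ → ℝ≥0∞} (hg : Measurable g) {p : ℝ≥0∞ → Prop}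
    (h₁ : p (∫⁻ y, g |(|x| - y)| ∂densityLaw v₁)) (h₂ : p (∫⁻ y, g |(|x| - y)| ∂densityLaw v₂)) :
    p (∫⁻ z, g |z| ∂κ x) := by
  rcases lt_or_gt_of_ne hx with h | h
  · rw [hκ.eq_map_of_neg h, lintegral_map (by fun_prop) (by fun_prop)]
    rw [abs_of_neg h] at h₂
    simpa only [← abs_neg (x + _), neg_add'] using h₂
  · rw [hκ.eq_map_of_pos h, lintegral_map (by fun_prop) (by fun_prop)]
    rwa [abs_of_pos h] at h₁

end IsOscillatingKernel

/-! ### Upper bounds for the drift -/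

lemma abs_sub_rpow_le {ν r y : ℝ} (hν : 0 ≤ ν) (hr : 0 ≤ r) (hy : 0 ≤ y) :
    |r - y| ^ ν ≤ r ^ ν + y ^ ν := by
  have h1 : 0 ≤ r ^ ν := by positivity
  have h2 : 0 ≤ y ^ ν := by positivity
  rcases le_total y r with h | h
  · have : |r - y| ≤ r := by rw [abs_of_nonneg (by linarith)]; linarith
    linarith [Real.rpow_le_rpow (abs_nonneg _) this hν]
  · have : |r - y| ≤ y := by rw [abs_of_nonpos (by linarith)]; linarith
    linarith [Real.rpow_le_rpow (abs_nonneg _) this hν]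

lemma abs_sub_rpow_eq {ν r : ℝ} (hr : 0 < r) (y : ℝ) :
    |r - y| ^ ν = r ^ ν * |1 - y / r| ^ ν := by
  rw [← Real.mul_rpow hr.le (abs_nonneg _)]
  congr 1
  rw [← abs_of_pos hr, ← abs_mul, abs_of_pos hr, mul_sub, mul_one, mul_div_cancel₀ _ hr.ne']

namespace IsHeavyTailedDensity

variable {α c : ℝ} {v : ℝ → ℝ}

lemma integrable_abs_sub_rpow (hv : IsHeavyTailedDensity α c v) {ν : ℝ} (h0 : 0 ≤ ν) (hν : ν < α)
    {r : ℝ} (hr : 0 ≤ r) : Integrable (fun y => |r - y| ^ ν) (densityLaw v) := by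
  have := hv.density.isProbabilityMeasure
  refine ((integrable_const (r ^ ν)).add (hv.integrable_rpow h0 hν)).mono' (by fun_prop) ?_
  filter_upwards [hv.ae_pos] with y hy
  rw [Real.norm_of_nonneg (by positivity)]
  exact abs_sub_rpow_le h0 hr hy.le

/-- For α < 1 the majorant can be |1 - u| ^ ν - 1 itself. The freedom is for α = 1, where that
function is not integrable against u ^ (-1 - α) at 0. -/
lemma drift_le_of_majorant (hv : IsHeavyTailedDensity α c v) (hc : 0 < c) {ν : ℝ} (h0 : 0 ≤ ν)
    (hν : ν < α) {φ : ℝ → ℝ} (hφ : IntegrableOn (fun u => φ u * u ^ (-1 - α)) (Ioi 0))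
    (hle : ∀ u, 0 < u → |1 - u| ^ ν - 1 ≤ φ u)
    (hneg : ∫ u in Ioi 0, φ u * u ^ (-1 - α) < 0) :
    ∃ b > 0, ∀ᶠ r in atTop, ∫ y, |r - y| ^ ν ∂densityLaw v + b * r ^ (ν - α) ≤ r ^ ν := by
  have := hv.density.isProbabilityMeasure
  set I := ∫ u in Ioi 0, φ u * u ^ (-1 - α) with hI
  have hcI : c * I < 0 := mul_neg_of_pos_of_neg hc hneg
  refine ⟨-(c * I / 2), by linarith, ?_⟩
  filter_upwards [hv.integral_comp_div_le hφ (b := c * I / 2) (by linarith),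
    eventually_gt_atTop 0] with r hr hr0
  have hint := hv.integrable_comp_div hφ hr0
  have h1 : ∫ y, |r - y| ^ ν ∂densityLaw v ≤ ∫ y, (r ^ ν + r ^ ν * φ (y / r)) ∂densityLaw v := by
    refine integral_mono_ae (hv.integrable_abs_sub_rpow h0 hν hr0.le)
      ((integrable_const _).add (hint.const_mul _)) ?_
    filter_upwards [hv.ae_pos] with y hy
    rw [abs_sub_rpow_eq hr0]
    have h2 := hle (y / r) (by positivity)
    have h3 : 0 ≤ r ^ ν := by positivity
    nlinarith
  rw [integral_add (integrable_const _) (hint.const_mul _), integral_const_mul] at h1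
  simp only [integral_const, probReal_univ, one_smul] at h1
  have h4 : r ^ (ν - α) = r ^ ν * r ^ (-α) := by
    rw [← Real.rpow_add hr0]
    ring_nf
  have h5 := mul_le_mul_of_nonneg_left hr (by positivity : 0 ≤ r ^ ν)
  rw [h4]
  linarith

lemma drift_le_of_lt_one (hv : IsHeavyTailedDensity α c v) (hc : 0 < c) (hα1 : α < 1) {ν : ℝ}
    (h0 : 0 < ν) (hν : ν < 2 * α - 1) :
    ∃ b > 0, ∀ᶠ r in atTop, ∫ y, |r - y| ^ ν ∂densityLaw v + b * r ^ (ν - α) ≤ r ^ ν :=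
  hv.drift_le_of_majorant hc h0.le (by linarith) (φ := fun u => |1 - u| ^ ν - 1)
    (integrableOn_driftIntegrand h0.le (by linarith) hα1) (fun _ _ => le_rfl)
    (integral_driftIntegrand_neg hα1 h0 hν)

/-- The majorant is 0 on (0, δ], -ν u on (δ, 1] by Bernoulli, and u ^ ν beyond 1. Its integral is ν
log δ + (1 - ν)⁻¹, negative for small δ. -/
lemma drift_le_of_eq_one (hv : IsHeavyTailedDensity 1 c v) (hc : 0 < c) {ν : ℝ}
    (h0 : 0 < ν) (hν : ν < 1) :
    ∃ b > 0, ∀ᶠ r in atTop, ∫ y, |r - y| ^ ν ∂densityLaw v + b * r ^ (ν - 1) ≤ r ^ ν := by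
  obtain ⟨δ, hδ0, hδ1, hδ⟩ : ∃ δ : ℝ, 0 < δ ∧ δ < 1 ∧ ν * Real.log δ + (1 - ν)⁻¹ < 0 := by
    have h := (Real.tendsto_log_nhdsGT_zero.const_mul_atBot h0).eventually_lt_atBot (-(1 - ν)⁻¹)
    obtain ⟨δ, h1, h2⟩ := (h.and (Ioo_mem_nhdsGT one_pos)).exists
    exact ⟨δ, h2.1, h2.2, by linarith⟩
  set f : ℝ → ℝ := (Ioc δ 1).indicator fun u => -ν * u with hf
  set g : ℝ → ℝ := (Ioi 1).indicator fun u => u ^ ν with hg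
  have hf1 : ∀ u, f u * u ^ (-1 - 1 : ℝ) = (Ioc δ 1).indicator (fun u => -ν * u⁻¹) u := by
    intro u
    by_cases hu : u ∈ Ioc δ 1
    · have hu0 : 0 < u := hδ0.trans hu.1
      simp only [hf, indicator_of_mem hu]
      rw [show (-1 - 1 : ℝ) = -(2 : ℕ) by norm_num, Real.rpow_neg hu0.le, Real.rpow_natCast]
      field_simp
    · simp [hf, indicator_of_notMem hu]
  have hg1 : ∀ u, g u * u ^ (-1 - 1 : ℝ) = (Ioi 1).indicator (fun u => u ^ (ν - 2)) u := by
    intro u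
    by_cases hu : u ∈ Ioi (1 : ℝ)
    · have hu0 : 0 < u := one_pos.trans hu
      simp only [hg, indicator_of_mem hu]
      rw [← Real.rpow_add hu0]
      ring_nf
    · simp [hg, indicator_of_notMem hu]
  have hfi : IntegrableOn (fun u => -ν * u⁻¹) (Ioc δ 1) := by
    refine Integrable.const_mul ?_ _
    rw [← IntegrableOn, ← intervalIntegrable_iff_integrableOn_Ioc_of_le hδ1.le,
      intervalIntegrable_inv_iff]
    right
    rw [uIcc_of_le hδ1.le]
    exact fun h => absurd h.1 (not_le.2 hδ0)
  have hgi : IntegrableOn (fun u : ℝ => u ^ (ν - 2)) (Ioi 1) :=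
    integrableOn_Ioi_rpow_of_lt (by linarith) one_pos
  have hsum : (fun u => (f u + g u) * u ^ (-1 - 1 : ℝ)) =
      fun u => (Ioc δ 1).indicator (fun u => -ν * u⁻¹) u +
        (Ioi 1).indicator (fun u => u ^ (ν - 2)) u := by
    funext u
    rw [add_mul, hf1, hg1]
  have hfi' := ((integrable_indicator_iff measurableSet_Ioc).2 hfi).integrableOn (s := Ioi 0)
  have hgi' := ((integrable_indicator_iff measurableSet_Ioi).2 hgi).integrableOn (s := Ioi 0)
  refine hv.drift_le_of_majorant hc h0.le hν (φ := fun u => f u + g u) ?_ ?_ ?_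
  · rw [hsum]
    exact hfi'.add hgi'
  · intro u hu
    rcases le_or_gt u δ with h1 | h1
    · have h2 : f u = 0 := indicator_of_notMem (fun h => absurd h.1 (not_lt.2 h1)) _
      have h3 : g u = 0 := indicator_of_notMem (by simp; linarith) _
      rw [h2, h3, abs_of_nonneg (by linarith)]
      linarith [Real.rpow_le_one (by linarith : 0 ≤ 1 - u) (by linarith) h0.le]
    rcases le_or_gt u 1 with h2 | h2
    · have h3 : f u = -ν * u := indicator_of_mem (mem_Ioc.2 ⟨h1, h2⟩) _
      have h4 : g u = 0 := indicator_of_notMem (by simpa using h2) _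
      rw [h3, h4, abs_of_nonneg (by linarith)]
      have := rpow_one_add_le_one_add_mul_self (s := -u) (by linarith) h0.le hν.le
      rw [← sub_eq_add_neg] at this
      linarith
    · have h3 : f u = 0 := indicator_of_notMem (fun h => absurd h.2 (not_le.2 h2)) _
      have h4 : g u = u ^ ν := indicator_of_mem (mem_Ioi.2 h2) _
      rw [h3, h4, zero_add]
      exact (le_abs_self _).trans (abs_rpow_sub_one_le_rpow h0.le h2.le)
  · rw [hsum, integral_add hfi' hgi', setIntegral_indicator measurableSet_Ioc,
      setIntegral_indicator measurableSet_Ioi, inter_eq_right.2 (Ioi_subset_Ioi zero_le_one),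
      inter_eq_right.2 (fun u hu => mem_Ioi.2 (hδ0.trans hu.1)), integral_const_mul,
      ← intervalIntegral.integral_of_le hδ1.le, integral_inv_of_pos hδ0 one_pos,
      integral_Ioi_rpow_of_lt (by linarith) one_pos, Real.one_rpow, one_div, Real.log_inv]
    have : -1 / (ν - 2 + 1) = (1 - ν)⁻¹ := by
      rw [show ν - 2 + 1 = -(1 - ν) by ring, neg_div_neg_eq, one_div]
    rw [this]
    linarith

lemma integral_id_pos (hv : IsHeavyTailedDensity α c v) (hα : 1 < α) :
    0 < ∫ y, y ∂densityLaw v := by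
  have := hv.density.isProbabilityMeasure
  have hint : Integrable (fun y : ℝ => y) (densityLaw v) := by
    simpa using hv.integrable_rpow zero_le_one hα
  refine (integral_pos_iff_support_of_nonneg_ae (hv.ae_pos.mono fun y hy => hy.le) hint).2 ?_
  have h1 : densityLaw v (Ioi 0) = 1 := (mem_ae_iff_prob_eq_one measurableSet_Ioi).1 hv.ae_pos
  have h2 : Ioi (0 : ℝ) ⊆ Function.support fun y : ℝ => y := fun y hy => (mem_Ioi.1 hy).ne'
  exact (h1 ▸ one_pos : 0 < densityLaw v (Ioi 0)).trans_le (measure_mono h2)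

/-- The mean is finite, so r (|1 - Y / r| ^ ν - 1) converges in expectation to -ν E[Y]. It is
dominated by ν Y + Y ^ ν: by Bernoulli for Y ≤ r, and because r ≤ r ^ ν for Y ≥ r. -/
lemma drift_le_of_one_lt (hv : IsHeavyTailedDensity α c v) (hα : 1 < α) {ν : ℝ}
    (h1 : 1 ≤ ν) (hν : ν < α) :
    ∃ b > 0, ∀ᶠ r in atTop, ∫ y, |r - y| ^ ν ∂densityLaw v + b * r ^ (ν - 1) ≤ r ^ ν := by
  have := hv.density.isProbabilityMeasure
  have hν0 : 0 < ν := by linarith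
  have hint : Integrable (fun y : ℝ => y) (densityLaw v) := by
    simpa using hv.integrable_rpow zero_le_one hα
  have hμ := hv.integral_id_pos hα
  have key : Tendsto (fun r : ℝ => ∫ y, r * (|1 - y / r| ^ ν - 1) ∂densityLaw v) atTop
      (𝓝 (∫ y, -ν * y ∂densityLaw v)) := by
    refine tendsto_integral_filter_of_dominated_convergence (fun y => ν * y + y ^ ν)
      (Eventually.of_forall fun r => by
        have : Measurable fun y : ℝ => r * (|1 - y / r| ^ ν - 1) := by fun_prop
        exact this.aestronglyMeasurable) ?_
      ((hint.const_mul ν).add (hv.integrable_rpow hν0.le hν)) ?_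
    · filter_upwards [eventually_ge_atTop 1] with r hr
      filter_upwards [hv.ae_pos] with y hy
      have hr0 : 0 < r := by linarith
      rw [norm_mul, Real.norm_of_nonneg hr0.le, Real.norm_eq_abs]
      rcases le_total (y / r) 1 with hu | hu
      · have h2 : (1 - y / r) ^ ν ≤ 1 := Real.rpow_le_one (by linarith)
          (by linarith [div_nonneg hy.le hr0.le]) hν0.le
        have h3 := one_add_mul_self_le_rpow_one_add (s := -(y / r)) (by linarith) h1
        rw [← sub_eq_add_neg] at h3
        rw [abs_of_nonneg (by linarith : 0 ≤ 1 - y / r), abs_of_nonpos (by linarith)]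
        have h4 : r * -((1 - y / r) ^ ν - 1) ≤ r * (ν * (y / r)) := by
          gcongr
          linarith
        have h5 : r * (ν * (y / r)) = ν * y := by field_simp
        have h6 : 0 ≤ y ^ ν := by positivity
        linarith
      · have h2 : r * |(|1 - y / r| ^ ν - 1)| ≤ r ^ ν * (y / r) ^ ν := by
          gcongr
          · simpa using Real.rpow_le_rpow_of_exponent_le hr h1
          · exact abs_rpow_sub_one_le_rpow hν0.le hu
        rw [← Real.mul_rpow hr0.le (by positivity), mul_div_cancel₀ _ hr0.ne'] at h2
        have : 0 ≤ ν * y := by positivity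
        linarith
    · filter_upwards [hv.ae_pos] with y hy
      have hd : HasDerivAt (fun t : ℝ => (1 - y * t) ^ ν) (-ν * y) 0 := by
        have h2 : HasDerivAt (fun t : ℝ => 1 - y * t) (-y) 0 := by
          simpa using ((hasDerivAt_id (0 : ℝ)).const_mul y).const_sub 1
        refine (h2.rpow_const (Or.inl (by simp))).congr_deriv ?_
        simp
        ring
      have ht := (hasDerivAt_iff_tendsto_slope_zero.1 hd).comp
        (tendsto_inv_atTop_nhdsGT_zero.mono_right
          (nhdsWithin_mono _ (fun t (ht : (0 : ℝ) < t) => ht.ne')))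
      refine ht.congr' ?_
      filter_upwards [eventually_gt_atTop y, eventually_gt_atTop 0] with r hr hr0
      have h3 : y / r < 1 := (div_lt_one hr0).2 hr
      simp only [Function.comp_apply, inv_inv, zero_add, mul_zero, sub_zero, Real.one_rpow,
        smul_eq_mul, ← div_eq_mul_inv]
      rw [abs_of_pos (by linarith)]
  rw [integral_const_mul] at key
  set M := ∫ y, y ∂densityLaw v with hM
  have hνM : 0 < ν * M := by positivity
  refine ⟨ν * M / 2, by positivity, ?_⟩
  filter_upwards [key.eventually_le_const (u := -(ν * M / 2)) (by linarith),
    eventually_gt_atTop 0] with r hr hr0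
  have h2 : ∀ y, r * (|1 - y / r| ^ ν - 1) = r * (r ^ ν)⁻¹ * |r - y| ^ ν - r := by
    intro y
    have : r ^ ν ≠ 0 := by positivity
    rw [abs_sub_rpow_eq hr0]
    field_simp
  simp_rw [h2] at hr
  rw [integral_sub ((hv.integrable_abs_sub_rpow hν0.le hν hr0.le).const_mul _)
    (integrable_const _), integral_const_mul] at hr
  simp only [integral_const, probReal_univ, one_smul] at hr
  rw [Real.rpow_sub_one hr0.ne']
  have hrν : 0 < r ^ ν := by positivity
  have h4 := mul_le_mul_of_nonneg_left hr (by positivity : 0 ≤ r ^ ν / r)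
  have h5 : r ^ ν / r * (r * (r ^ ν)⁻¹ * ∫ y, |r - y| ^ ν ∂densityLaw v - r) =
      ∫ y, |r - y| ^ ν ∂densityLaw v - r ^ ν := by
    field_simp
  rw [h5] at h4
  linarith

/-- A drift inequality at infinity extends to a neighbourhood of the target after adding a constant
to the Lyapunov function. -/
lemma exists_lyapunov_drift (hv : IsHeavyTailedDensity α c v) {a : ℝ} (ha : 0 < a) {ν γ : ℝ}
    (h0 : 0 < ν) (hν : ν < α)
    (hdrift : ∃ b > 0, ∀ᶠ r in atTop,
      ∫ y, |r - y| ^ ν ∂densityLaw v + b * r ^ (ν - γ) ≤ r ^ ν) :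
    ∃ L₀ : ℝ, ∀ L, L₀ ≤ L → ∃ b₀ > 0, ∀ b, 0 < b → b ≤ b₀ → ∀ r, a < r →
      ∫⁻ y, (Ioi a).indicator (fun s => ENNReal.ofReal (s ^ ν + L)) |r - y| ∂densityLaw v +
        ENNReal.ofReal (b * (r ^ ν + L) ^ (1 - γ / ν)) ≤ ENNReal.ofReal (r ^ ν + L) := by
  have := hv.density.isProbabilityMeasure
  obtain ⟨b₁, hb₁, hev⟩ := hdrift
  obtain ⟨A, hA⟩ := eventually_atTop.1 (hev.and (eventually_ge_atTop 1))
  have hA1 : 1 ≤ A := (hA A le_rfl).2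
  obtain ⟨δ, hδ, hnear⟩ := hv.exists_le_measure_near ha A
  set B := A ^ ν + ∫ y, y ^ ν ∂densityLaw v with hB
  -- For r < A the expectation of the νth power is at most B, while hitting the target forfeits L
  -- with probability at least δ. L δ ≥ B + 1 leaves a drift of at most -1.
  refine ⟨max 1 ((B + 1) / δ), fun L hL => ?_⟩
  have hL1 : 1 ≤ L := (le_max_left _ _).trans hL
  have hLδ : B + 1 ≤ L * δ := by
    rw [← div_le_iff₀ hδ]
    exact (le_max_right _ _).trans hL
  set s := 1 - γ / ν with hs
  -- The first bound serves r ≥ A, the second r < A. The absolute value is there because s may have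
  -- either sign.
  refine ⟨min (b₁ / (1 + L) ^ |s|) (1 / (A ^ ν + L) ^ |s|), by positivity,
    fun b hb hbb r hr => ?_⟩
  have hr0 : 0 < r := ha.trans hr
  set near : Set ℝ := {y | |r - y| ≤ a} with hnr
  have hnm : MeasurableSet near := measurableSet_le (by fun_prop) measurable_const
  -- F removes only the constant L on the target, not the power, and so dominates the killed
  -- function.
  set F : ℝ → ℝ := fun y => |r - y| ^ ν + (L - L * near.indicator (fun _ => 1) y) with hF
  have hi1 := hv.integrable_abs_sub_rpow h0.le hν hr0.le
  have hi2 : Integrable (fun y => near.indicator (fun _ => (1 : ℝ)) y) (densityLaw v) :=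
    (integrable_const _).indicator hnm
  have hF0 : ∀ y, 0 ≤ F y := by
    intro y
    have : near.indicator (fun _ => (1 : ℝ)) y ≤ 1 := indicator_le_self' (by simp) y
    have h2 : 0 ≤ |r - y| ^ ν := by positivity
    simp only [hF]
    nlinarith
  have hFi : Integrable F (densityLaw v) :=
    hi1.add ((integrable_const L).sub (hi2.const_mul L))
  have hle : ∫⁻ y, (Ioi a).indicator (fun s => ENNReal.ofReal (s ^ ν + L)) |r - y| ∂densityLaw v ≤
      ENNReal.ofReal (∫ y, F y ∂densityLaw v) := by
    rw [ofReal_integral_eq_lintegral_ofReal hFi (Eventually.of_forall hF0)]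
    refine lintegral_mono fun y => ?_
    by_cases hy : |r - y| ∈ Ioi a
    · have hy' : y ∉ near := fun h => absurd (mem_Ioi.1 hy) (not_lt.2 h)
      simp only [hF, indicator_of_mem hy, indicator_of_notMem hy']
      exact ENNReal.ofReal_le_ofReal (by linarith)
    · simp only [indicator_of_notMem hy]
      exact zero_le
  have hFint : ∫ y, F y ∂densityLaw v =
      ∫ y, |r - y| ^ ν ∂densityLaw v + (L - L * (densityLaw v).real near) := by
    simp only [hF]
    rw [integral_add hi1 (g := fun y => L - L * near.indicator (fun _ => 1) y) ((integrable_const L).sub (hi2.const_mul L)),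
      integral_sub (integrable_const L) (hi2.const_mul L), integral_const_mul,
      integral_indicator hnm]
    simp
  have hFnn : 0 ≤ ∫ y, F y ∂densityLaw v := integral_nonneg hF0
  have hX1 : 1 ≤ r ^ ν + L := by
    have : 0 ≤ r ^ ν := by positivity
    linarith
  refine (add_le_add_left hle _).trans ?_
  rw [← ENNReal.ofReal_add hFnn (by positivity), hFint]
  refine ENNReal.ofReal_le_ofReal ?_
  rcases le_or_gt A r with hAr | hAr
  · obtain ⟨hd, hr1⟩ := hA r hAr
    have hrν : 1 ≤ r ^ ν := Real.one_le_rpow hr1 h0.le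
    have h1 : (r ^ ν + L) ^ s ≤ r ^ (ν - γ) * (1 + L) ^ |s| := by
      have h2 : r ^ ν + L = r ^ ν * (1 + L / r ^ ν) := by field_simp
      have h3 : r ^ (ν - γ) = (r ^ ν) ^ s := by
        rw [← Real.rpow_mul hr0.le, hs]
        congr 1
        field_simp
      have h4 : L / r ^ ν ≤ L := div_le_self (by linarith) hrν
      have h5 : 0 ≤ L / r ^ ν := by positivity
      rw [h2, h3, Real.mul_rpow (by positivity) (by positivity)]
      gcongr
      calc (1 + L / r ^ ν) ^ s ≤ (1 + L / r ^ ν) ^ |s| :=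
            Real.rpow_le_rpow_of_exponent_le (by linarith) (le_abs_self s)
        _ ≤ _ := by gcongr
    have h6 : b * (r ^ ν + L) ^ s ≤ b₁ * r ^ (ν - γ) := by
      calc b * (r ^ ν + L) ^ s ≤ (b₁ / (1 + L) ^ |s|) * (r ^ (ν - γ) * (1 + L) ^ |s|) := by
            gcongr
            exact hbb.trans (min_le_left _ _)
        _ = _ := by field_simp
    have h7 : 0 ≤ L * (densityLaw v).real near := by positivity
    linarith
  · have h1 : ∫ y, |r - y| ^ ν ∂densityLaw v ≤ B := by
      have h2 : ∫ y, |r - y| ^ ν ∂densityLaw v ≤ ∫ y, (A ^ ν + y ^ ν) ∂densityLaw v := by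
        refine integral_mono_ae hi1 ((integrable_const _).add (hv.integrable_rpow h0.le hν)) ?_
        filter_upwards [hv.ae_pos] with y hy
        refine (abs_sub_rpow_le h0.le hr0.le hy.le).trans ?_
        gcongr
      rw [integral_add (integrable_const _) (hv.integrable_rpow h0.le hν)] at h2
      simpa using h2
    have h3 : L * δ ≤ L * (densityLaw v).real near := by
      gcongr
      exact hnear r ⟨hr.le, hAr.le⟩
    have h4 : b * (r ^ ν + L) ^ s ≤ 1 := by
      calc b * (r ^ ν + L) ^ s ≤ (1 / (A ^ ν + L) ^ |s|) * (A ^ ν + L) ^ |s| := by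
            gcongr
            · exact hbb.trans (min_le_right _ _)
            · calc (r ^ ν + L) ^ s ≤ (r ^ ν + L) ^ |s| :=
                    Real.rpow_le_rpow_of_exponent_le hX1 (le_abs_self s)
                _ ≤ _ := by gcongr
        _ = 1 := by field_simp
    have h5 : 0 ≤ r ^ ν := by positivity
    linarith

end IsHeavyTailedDensity

/-! ### Finite moments below the critical exponent -/

namespace IsMarkovChainFrom

variable {Ω : Type*} {m : MeasurableSpace Ω} {P : Measure Ω} [IsProbabilityMeasure P]
  {ℱ : Filtration ℕ m} {κ : Kernel ℝ ℝ} [IsMarkovKernel κ] {x : ℝ} {Z : ℕ → Ω → ℝ} {a : ℝ}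
  {α c₁ c₂ : ℝ} {v₁ v₂ : ℝ → ℝ}

lemma exists_tail_le_of_drift (hZ : IsMarkovChainFrom P ℱ κ x Z)
    (hκ : IsOscillatingKernel (fun y => v₁ (-y)) v₂ κ)
    (hv₁ : IsHeavyTailedDensity α c₁ v₁) (hv₂ : IsHeavyTailedDensity α c₂ v₂)
    (ha : 0 < a) (hx : a < |x|) {ν γ : ℝ} (h0 : 0 < ν) (hν : ν < α) (hγ : 0 < γ)
    (h₁ : ∃ b > 0, ∀ᶠ r in atTop, ∫ y, |r - y| ^ ν ∂densityLaw v₁ + b * r ^ (ν - γ) ≤ r ^ ν)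
    (h₂ : ∃ b > 0, ∀ᶠ r in atTop, ∫ y, |r - y| ^ ν ∂densityLaw v₂ + b * r ^ (ν - γ) ≤ r ^ ν) :
    ∃ C : ℝ, ∀ N : ℕ, 1 ≤ N →
      P {ω | (N : ℕ∞) < passageTime Z a ω} ≤ ENNReal.ofReal (C * (N : ℝ) ^ (-(ν / γ))) := by
  obtain ⟨L₁, hL₁⟩ := hv₁.exists_lyapunov_drift ha h0 hν h₁
  obtain ⟨L₂, hL₂⟩ := hv₂.exists_lyapunov_drift ha h0 hν h₂
  set L := max 1 (max L₁ L₂) with hL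
  have hL1 : 1 ≤ L := le_max_left _ _
  obtain ⟨b₁, hb₁, hd₁⟩ := hL₁ L ((le_max_left _ _).trans (le_max_right _ _))
  obtain ⟨b₂, hb₂, hd₂⟩ := hL₂ L ((le_max_right _ _).trans (le_max_right _ _))
  set b := min b₁ b₂ with hb
  have hb0 : 0 < b := lt_min hb₁ hb₂
  -- Normalized so that h ^ (ν / γ) is the Lyapunov function and h ^ (ν / γ - 1) is its drift rate;
  -- the tail exponent is then ν / γ.
  set h : ℝ → ℝ := fun y => (|y| ^ ν + L) ^ (γ / ν) with hh
  have hX : ∀ y : ℝ, 0 < |y| ^ ν + L := fun y => by positivity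
  have hq : ∀ y, h y ^ (ν / γ) = |y| ^ ν + L := by
    intro y
    simp only [hh]
    rw [← Real.rpow_mul (hX y).le, div_mul_div_cancel₀ h0.ne', div_self hγ.ne', Real.rpow_one]
  have hq1 : ∀ y, h y ^ (ν / γ - 1) = (|y| ^ ν + L) ^ (1 - γ / ν) := by
    intro y
    simp only [hh]
    rw [← Real.rpow_mul (hX y).le]
    congr 1
    field_simp
  have hm : Measurable h := by fun_prop
  have hpos : ∀ y, a < |y| → 0 < h y := fun y _ => Real.rpow_pos_of_pos (hX y) _
  have hdrift : ∀ y, a < |y| →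
      ∫⁻ z in {z | a < |z|}, ENNReal.ofReal (h z ^ (ν / γ)) ∂κ y +
        ENNReal.ofReal (b * h y ^ (ν / γ - 1)) ≤ ENNReal.ofReal (h y ^ (ν / γ)) := by
    intro y hy
    have hy0 : y ≠ 0 := by
      rintro rfl
      simp at hy
      linarith
    simp_rw [hq, hq1]
    have hg : Measurable ((Ioi a).indicator fun s : ℝ => ENNReal.ofReal (s ^ ν + L)) :=
      Measurable.indicator (by fun_prop) measurableSet_Ioi
    rw [← lintegral_indicator (measurableSet_lt_abs a)]
    exact hκ.lintegral_abs_induction hy0 hg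
      (p := fun I => I + ENNReal.ofReal (b * (|y| ^ ν + L) ^ (1 - γ / ν)) ≤
        ENNReal.ofReal (|y| ^ ν + L))
      (hd₁ b hb0 (min_le_left _ _) _ hy) (hd₂ b hb0 (min_le_right _ _) _ hy)
  rcases le_total (ν / γ) 1 with hle | hle
  · exact hZ.exists_tail_le_of_le_one hx (by positivity) hle hb0 hm hpos hdrift
  · exact hZ.exists_tail_le_of_one_le hx hle hb0 hm hpos hdrift

lemma passageMoment_lt_top_of_one_le (hZ : IsMarkovChainFrom P ℱ κ x Z)
    (hκ : IsOscillatingKernel (fun y => v₁ (-y)) v₂ κ) (hc₁ : 0 < c₁) (hc₂ : 0 < c₂)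
    (hv₁ : IsHeavyTailedDensity α c₁ v₁) (hv₂ : IsHeavyTailedDensity α c₂ v₂)
    (ha : 0 < a) (hx : a < |x|) (hα : 1 ≤ α) {q : ℝ} (hq : q < α) :
    passageMoment P Z a q < ⊤ := by
  rcases hα.eq_or_lt with rfl | hα
  · obtain ⟨ν, h1, h2⟩ := exists_between (max_lt one_pos hq)
    have h0 : 0 < ν := (le_max_left _ _).trans_lt h1
    obtain ⟨C, hC⟩ := hZ.exists_tail_le_of_drift hκ hv₁ hv₂ ha hx h0 h2 one_pos
      (hv₁.drift_le_of_eq_one hc₁ h0 h2) (hv₂.drift_le_of_eq_one hc₂ h0 h2)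
    rw [div_one] at hC
    exact hZ.passageMoment_lt_top hx h0 hC ((le_max_right _ _).trans_lt h1)
  · obtain ⟨ν, h1, h2⟩ := exists_between (max_lt hα hq)
    have h0 : 1 < ν := (le_max_left _ _).trans_lt h1
    obtain ⟨C, hC⟩ := hZ.exists_tail_le_of_drift hκ hv₁ hv₂ ha hx (by linarith) h2 one_pos
      (hv₁.drift_le_of_one_lt hα h0.le h2) (hv₂.drift_le_of_one_lt hα h0.le h2)
    rw [div_one] at hC
    exact hZ.passageMoment_lt_top hx (by linarith) hC ((le_max_right _ _).trans_lt h1)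

lemma passageMoment_lt_top_of_lt_one (hZ : IsMarkovChainFrom P ℱ κ x Z)
    (hκ : IsOscillatingKernel (fun y => v₁ (-y)) v₂ κ) (hc₁ : 0 < c₁) (hc₂ : 0 < c₂)
    (hv₁ : IsHeavyTailedDensity α c₁ v₁) (hv₂ : IsHeavyTailedDensity α c₂ v₂)
    (ha : 0 < a) (hx : a < |x|) (hα : 1 / 2 < α) (hα1 : α < 1) {q : ℝ} (hq : q < 2 - 1 / α) :
    passageMoment P Z a q < ⊤ := by
  have hα0 : 0 < α := by linarith
  have h2α : 2 - 1 / α = (2 * α - 1) / α := by field_simp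
  obtain ⟨p, h1, h2⟩ := exists_between (max_lt (by rw [h2α]; exact div_pos (by linarith) hα0) hq)
  have hp0 : 0 < p := (le_max_left _ _).trans_lt h1
  rw [h2α, lt_div_iff₀ hα0] at h2
  have h0 : 0 < p * α := by positivity
  obtain ⟨C, hC⟩ := hZ.exists_tail_le_of_drift hκ hv₁ hv₂ ha hx h0 (by linarith) hα0
    (hv₁.drift_le_of_lt_one hc₁ hα1 h0 h2) (hv₂.drift_le_of_lt_one hc₂ hα1 h0 h2)
  rw [mul_div_cancel_right₀ _ hα0.ne'] at hC
  exact hZ.passageMoment_lt_top hx hp0 hC ((le_max_right _ _).trans_lt h1)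

end IsMarkovChainFrom

/-! ### Lower bounds for the survival probability -/

lemma ofReal_integral_le_lintegral_ofReal {Ω : Type*} {m : MeasurableSpace Ω} {μ : Measure Ω}
    {f : Ω → ℝ} (hf : Integrable f μ) :
    ENNReal.ofReal (∫ ω, f ω ∂μ) ≤ ∫⁻ ω, ENNReal.ofReal (f ω) ∂μ := by
  have h1 : ∫ ω, f ω ∂μ ≤ ∫ ω, max (f ω) 0 ∂μ :=
    integral_mono hf hf.pos_part fun ω => le_max_left _ _
  refine (ENNReal.ofReal_le_ofReal h1).trans ?_
  rw [ofReal_integral_eq_lintegral_ofReal hf.pos_part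
    (Eventually.of_forall fun ω => le_max_right _ _)]
  refine lintegral_mono fun ω => ?_
  simp [ENNReal.ofReal_max]

/-- The function `s ↦ s ^ ν` truncated at level `S ^ ν` and shifted down by `A ^ ν`. -/
noncomputable def truncatedPower (ν A S s : ℝ) : ℝ := max 0 (min (s ^ ν) (S ^ ν) - A ^ ν)

lemma measurable_truncatedPower (ν A S : ℝ) : Measurable (truncatedPower ν A S) := by
  unfold truncatedPower
  fun_prop

lemma truncatedPower_nonneg (ν A S s : ℝ) : 0 ≤ truncatedPower ν A S s := le_max_left _ _

lemma truncatedPower_le {ν A S s : ℝ} (hA : 0 ≤ A) (hS : 0 ≤ S) :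
    truncatedPower ν A S s ≤ S ^ ν := by
  have h1 : 0 ≤ A ^ ν := by positivity
  have h2 : 0 ≤ S ^ ν := by positivity
  refine max_le h2 ?_
  linarith [min_le_right (s ^ ν) (S ^ ν)]

lemma truncatedPower_eq_zero {ν A S s : ℝ} (hν : 0 ≤ ν) (hs : 0 ≤ s) (hsA : s ≤ A) :
    truncatedPower ν A S s = 0 := by
  refine max_eq_left ?_
  linarith [min_le_left (s ^ ν) (S ^ ν), Real.rpow_le_rpow hs hsA hν]

namespace IsHeavyTailedDensity

variable {α c : ℝ} {v : ℝ → ℝ}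

lemma le_measure_Ioi (hv : IsHeavyTailedDensity α c v) (hα : 0 < α) (hc : 0 < c) :
    ∃ b > 0, ∀ᶠ R in atTop, b * R ^ (-α) ≤ (densityLaw v).real (Ioi R) := by
  have hφ := integrableOn_indicator_rpow (α := α) (β := 0) hα
  have hI : ∫ u in Ioi (0 : ℝ), (Ioi (1 : ℝ)).indicator (fun u => u ^ (0 : ℝ)) u * u ^ (-1 - α) =
      α⁻¹ := by
    have h1 : ∀ u : ℝ, (Ioi (1 : ℝ)).indicator (fun u => u ^ (0 : ℝ)) u * u ^ (-1 - α) =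
        (Ioi (1 : ℝ)).indicator (fun u => u ^ (-1 - α)) u := by
      intro u
      by_cases hu : u ∈ Ioi (1 : ℝ) <;> simp [hu]
    simp_rw [h1]
    rw [setIntegral_indicator measurableSet_Ioi, inter_eq_right.2 (Ioi_subset_Ioi zero_le_one),
      integral_Ioi_rpow_of_lt (by linarith) one_pos, Real.one_rpow]
    ring_nf
  refine ⟨c * α⁻¹ / 2, by positivity, ?_⟩
  have h0 : 0 < c * α⁻¹ := by positivity
  filter_upwards [hv.le_integral_comp_div hφ (b := c * α⁻¹ / 2) (by rw [hI]; linarith),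
    eventually_gt_atTop 0] with R hR hR0
  refine hR.trans (le_of_eq ?_)
  rw [← integral_indicator_one measurableSet_Ioi]
  congr 1
  funext y
  by_cases hy : R < y
  · rw [indicator_of_mem (mem_Ioi.2 ((one_lt_div hR0).2 hy)), indicator_of_mem (mem_Ioi.2 hy)]
    simp
  · have hyR : y / R ∉ Ioi (1 : ℝ) := fun h => hy ((one_lt_div hR0).1 h)
    have hyI : y ∉ Ioi R := hy
    rw [indicator_of_notMem hyR, indicator_of_notMem hyI]

lemma integrableOn_min_one_mul {α k : ℝ} (hα0 : 0 < α) (hα1 : α < 1) (hk : 0 < k) :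
    IntegrableOn (fun u : ℝ => min 1 (k * u) * u ^ (-1 - α)) (Ioi 0) := by
  have hm : Measurable fun u : ℝ => min 1 (k * u) * u ^ (-1 - α) := by fun_prop
  rw [← Ioc_union_Ioi_eq_Ioi (zero_le_one' ℝ)]
  refine IntegrableOn.union ?_ ?_
  · have h : IntegrableOn (fun u : ℝ => u ^ (-α)) (Ioc 0 1) :=
      (intervalIntegrable_iff_integrableOn_Ioc_of_le zero_le_one).1
        (intervalIntegral.intervalIntegrable_rpow' (by linarith))
    refine (h.const_mul k).mono' hm.aestronglyMeasurable ?_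
    refine (ae_restrict_iff' measurableSet_Ioc).2 (Eventually.of_forall fun u hu => ?_)
    have hu0 : 0 < u := hu.1
    have h1 : u ^ (-α) = u * u ^ (-1 - α) := by
      rw [← Real.rpow_one_add' hu0.le (by linarith)]
      ring_nf
    rw [Real.norm_of_nonneg (by positivity), h1, ← mul_assoc]
    gcongr
    exact min_le_right _ _
  · have h : IntegrableOn (fun u : ℝ => u ^ (-1 - α)) (Ioi 1) :=
      integrableOn_Ioi_rpow_of_lt (by linarith) one_pos
    refine h.mono' hm.aestronglyMeasurable ?_
    refine (ae_restrict_iff' measurableSet_Ioi).2 (Eventually.of_forall fun u hu => ?_)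
    have hu0 : 0 < u := one_pos.trans hu
    rw [Real.norm_of_nonneg (by positivity)]
    exact mul_le_of_le_one_left (by positivity) (min_le_left _ _)

lemma le_drift_of_lt_one (hv : IsHeavyTailedDensity α c v) (hc : 0 < c) (hα : 1 / 2 < α)
    (hα1 : α < 1) {ν : ℝ} (hν : 2 * α - 1 < ν) (hνα : ν < α) :
    ∃ b > 0, ∀ᶠ r in atTop, r ^ ν + b * r ^ (ν - α) ≤ ∫ y, |r - y| ^ ν ∂densityLaw v := by
  have := hv.density.isProbabilityMeasure
  have h0 : 0 ≤ ν := by linarith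
  have hφ := integrableOn_driftIntegrand h0 hνα hα1
  have hI := integral_driftIntegrand_pos hα hα1 hν hνα
  set I := ∫ u in Ioi 0, driftIntegrand α ν u with hIdef
  have hcI : 0 < c * I := mul_pos hc hI
  refine ⟨c * I / 2, by positivity, ?_⟩
  filter_upwards [hv.le_integral_comp_div (φ := fun u => |1 - u| ^ ν - 1) hφ (b := c * I / 2)
    (by change c * I / 2 < c * I; linarith), eventually_gt_atTop 0] with r hr hr0
  have h2 : ∀ y, |1 - y / r| ^ ν - 1 = (r ^ ν)⁻¹ * |r - y| ^ ν - 1 := by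
    intro y
    have : r ^ ν ≠ 0 := by positivity
    rw [abs_sub_rpow_eq hr0]
    field_simp
  simp_rw [h2] at hr
  rw [integral_sub ((hv.integrable_abs_sub_rpow h0 hνα hr0.le).const_mul _)
    (integrable_const _), integral_const_mul] at hr
  simp only [integral_const, probReal_univ, one_smul] at hr
  have h4 : r ^ (ν - α) = r ^ ν * r ^ (-α) := by
    rw [← Real.rpow_add hr0]
    ring_nf
  have hrν : 0 < r ^ ν := by positivity
  have h5 := mul_le_mul_of_nonneg_left hr hrν.le
  rw [mul_sub, ← mul_assoc (r ^ ν), ← mul_assoc (r ^ ν), mul_inv_cancel₀ hrν.ne'] at h5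
  rw [h4]
  linarith

/-- Far from the target, where truncation matters, a jump lowers the truncated power at most by a
factor that is linear in the jump. -/
lemma truncatedPower_sub_ge {ν A S ε r y : ℝ} (h0 : 0 ≤ ν) (hν1 : ν ≤ 1) (hA : 0 ≤ A) (hε : 0 < ε)
    (hε1 : ε ≤ 1) (hS : 0 < S) (hAS : A ^ ν ≤ (ε * S) ^ ν / 2) (hr : ε * S ≤ r) (hy : 0 < y) :
    truncatedPower ν A S r * (1 - min 1 (2 / ε * (y / S))) ≤ truncatedPower ν A S |r - y| := by
  have hεS : 0 < ε * S := by positivity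
  rcases le_or_gt 1 (2 / ε * (y / S)) with h | h
  · rw [min_eq_left h, sub_self, mul_zero]
    exact truncatedPower_nonneg _ _ _ _
  · rw [min_eq_right h.le]
    set ρ := min r S with hρ
    have hρS : ε * S ≤ ρ := le_min hr (mul_le_of_le_one_left hS.le hε1)
    have hρ0 : 0 < ρ := hεS.trans_le hρS
    have hy2 : 2 * y < ε * S := by
      have : 2 / ε * (y / S) = 2 * y / (ε * S) := by field_simp
      rwa [this, div_lt_one hεS] at h
    have hyρ : y / ρ < 1 := by
      rw [div_lt_one hρ0]
      linarith
    have hρr : ρ ≤ r := min_le_left _ _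
    have hρS' : ρ ≤ S := min_le_right _ _
    have hρA : A ^ ν ≤ ρ ^ ν / 2 := hAS.trans (by gcongr)
    have hAν : 0 ≤ A ^ ν := by positivity
    have h1 : truncatedPower ν A S r = ρ ^ ν - A ^ ν := by
      have hmin : min (r ^ ν) (S ^ ν) = ρ ^ ν := by
        rcases le_total r S with h | h
        · rw [hρ, min_eq_left h, min_eq_left (Real.rpow_le_rpow (by linarith) h h0)]
        · rw [hρ, min_eq_right h, min_eq_right (Real.rpow_le_rpow (by linarith) h h0)]
      rw [truncatedPower, hmin, max_eq_right]
      linarith [Real.rpow_nonneg hρ0.le ν]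
    have h2 : ρ ^ ν - ρ ^ ν * (y / ρ) ≤ min (|r - y| ^ ν) (S ^ ν) := by
      have h3 : ρ ^ ν - ρ ^ ν * (y / ρ) ≤ (ρ - y) ^ ν := by
        have h4 : ρ - y = ρ * (1 - y / ρ) := by field_simp
        have h5 : 1 - y / ρ ≤ (1 - y / ρ) ^ ν := by
          simpa using Real.rpow_le_rpow_of_exponent_ge' (by linarith : 0 ≤ 1 - y / ρ)
            (by linarith [div_pos hy hρ0]) h0 hν1
        rw [h4, Real.mul_rpow hρ0.le (by linarith)]
        nlinarith [Real.rpow_nonneg hρ0.le ν]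
      have h6 : 0 ≤ ρ - y := by linarith
      refine le_min (h3.trans ?_) (h3.trans (Real.rpow_le_rpow h6 (by linarith) h0))
      rw [abs_of_nonneg (by linarith)]
      exact Real.rpow_le_rpow h6 (by linarith) h0
    have h7 : ρ ^ ν * (y / ρ) ≤ (ρ ^ ν - A ^ ν) * (2 / ε * (y / S)) := by
      have h8 : y / ρ ≤ y / (ε * S) := by gcongr
      calc ρ ^ ν * (y / ρ) ≤ (2 * (ρ ^ ν - A ^ ν)) * (y / (ε * S)) := by
            gcongr
            · linarith [Real.rpow_nonneg hρ0.le ν]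
            · linarith
        _ = _ := by field_simp
    rw [h1, mul_sub, mul_one]
    refine le_trans ?_ (le_max_right _ _)
    linarith

/-- Near the target the truncation costs at most the contribution of the jumps exceeding `S`. -/
lemma le_truncatedPower_sub {ν A S r y : ℝ} (h0 : 0 ≤ ν) (hA : 0 ≤ A) (hr : 0 ≤ r) (hS : 0 < S)
    (hrS : r < S) (hy : 0 < y) :
    |r - y| ^ ν - A ^ ν - S ^ ν * (Ioi 1).indicator (fun u => u ^ ν) (y / S) ≤
      truncatedPower ν A S |r - y| := by
  have hind : S ^ ν * (Ioi 1).indicator (fun u => u ^ ν) (y / S) = (Ioi S).indicator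
      (fun y => y ^ ν) y := by
    by_cases h : S < y
    · rw [indicator_of_mem (mem_Ioi.2 ((one_lt_div hS).2 h)), indicator_of_mem (mem_Ioi.2 h),
        ← Real.mul_rpow hS.le (by positivity), mul_div_cancel₀ _ hS.ne']
    · have hyS : y / S ∉ Ioi (1 : ℝ) := fun h' => h ((one_lt_div hS).1 h')
      have hyI : y ∉ Ioi S := h
      rw [indicator_of_notMem hyS, indicator_of_notMem hyI, mul_zero]
  rw [hind]
  have hAν : 0 ≤ A ^ ν := by positivity
  rcases le_or_gt |r - y| S with h | h
  · have h1 : 0 ≤ (Ioi S).indicator (fun y => y ^ ν) y :=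
      indicator_apply_nonneg fun _ => by positivity
    refine le_trans ?_ (le_max_right _ _)
    rw [min_eq_left (Real.rpow_le_rpow (abs_nonneg _) h h0)]
    linarith
  · have hyr : r ≤ y := by
      by_contra! hlt
      rw [abs_of_pos (by linarith)] at h
      linarith
    have habs : |r - y| = y - r := by rw [abs_sub_comm, abs_of_nonneg (by linarith)]
    have hyS : y ∈ Ioi S := by
      rw [habs] at h
      exact mem_Ioi.2 (by linarith)
    rw [indicator_of_mem hyS]
    have h2 : |r - y| ^ ν ≤ y ^ ν := Real.rpow_le_rpow (abs_nonneg _) (by linarith) h0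
    linarith [truncatedPower_nonneg ν A S |r - y|]

lemma integrable_truncatedPower (hv : IsHeavyTailedDensity α c v) {ν A S : ℝ} (hA : 0 ≤ A)
    (hS : 0 ≤ S) (r : ℝ) : Integrable (fun y => truncatedPower ν A S |r - y|) (densityLaw v) := by
  have := hv.density.isProbabilityMeasure
  refine (integrable_const (S ^ ν)).mono'
    ((measurable_truncatedPower ν A S).comp (by fun_prop)).aestronglyMeasurable
    (Eventually.of_forall fun y => ?_)
  rw [Real.norm_of_nonneg (truncatedPower_nonneg _ _ _ _)]
  exact truncatedPower_le hA hS

/-- Below ε S the positive drift b r ^ (ν - α) outweighs the truncation loss, of order S ^ (ν - α)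
from jumps beyond S. Above ε S the relative loss has expectation O(S ^ (-α)). C does not depend on
A, so one A and one C can serve both laws. -/
lemma truncatedPower_le_integral (hv : IsHeavyTailedDensity α c v) (hc : 0 < c) (hα : 1 / 2 < α)
    (hα1 : α < 1) {ν : ℝ} (hν : 2 * α - 1 < ν) (hνα : ν < α) :
    ∃ C > 0, ∀ᶠ A in atTop, ∀ᶠ S in atTop, ∀ r, A < r →
      (1 - C * S ^ (-α)) * truncatedPower ν A S r ≤
        ∫ y, truncatedPower ν A S |r - y| ∂densityLaw v := by
  have := hv.density.isProbabilityMeasure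
  have h0 : 0 < ν := by linarith
  obtain ⟨b, hb, hdrift⟩ := hv.le_drift_of_lt_one hc hα hα1 hν hνα
  have hφ₂ := integrableOn_indicator_rpow hνα
  obtain ⟨C₂, hC₂⟩ := exists_gt (max 0
    (c * ∫ u in Ioi (0 : ℝ), (Ioi (1 : ℝ)).indicator (fun u => u ^ ν) u * u ^ (-1 - α)))
  have hC₂0 : 0 < C₂ := (le_max_left _ _).trans_lt hC₂
  have hbig := hv.integral_comp_div_le hφ₂ ((le_max_right _ _).trans_lt hC₂)
  -- Possible since ν < α makes ε ^ (ν - α) blow up as ε tends to 0.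
  obtain ⟨ε, hε0, hε1, hε⟩ : ∃ ε : ℝ, 0 < ε ∧ ε < 1 ∧ C₂ ≤ b * ε ^ (ν - α) := by
    have h := (tendsto_rpow_neg_nhdsGT_zero (y := ν - α) (by linarith)).const_mul_atTop hb
    obtain ⟨ε, h1, h2⟩ := ((h.eventually_ge_atTop C₂).and (Ioo_mem_nhdsGT one_pos)).exists
    exact ⟨ε, h2.1, h2.2, h1⟩
  have hφ₁ := integrableOn_min_one_mul (α := α) (k := 2 / ε) (by linarith) hα1 (by positivity)
  obtain ⟨C₁, hC₁⟩ := exists_gt (max 0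
    (c * ∫ u in Ioi (0 : ℝ), min 1 (2 / ε * u) * u ^ (-1 - α)))
  have hC₁0 : 0 < C₁ := (le_max_left _ _).trans_lt hC₁
  have hsmall := hv.integral_comp_div_le hφ₁ ((le_max_right _ _).trans_lt hC₁)
  refine ⟨C₁, hC₁0, ?_⟩
  obtain ⟨A₁, hA₁⟩ := eventually_atTop.1 hdrift
  filter_upwards [eventually_ge_atTop A₁, eventually_gt_atTop 0] with A hAA hA0
  have hlarge : ∀ᶠ S in atTop, A ^ ν ≤ (ε * S) ^ ν / 2 := by
    have : Tendsto (fun S : ℝ => (ε * S) ^ ν / 2) atTop atTop :=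
      ((tendsto_rpow_atTop h0).comp (tendsto_id.const_mul_atTop hε0)).atTop_div_const two_pos
    exact this.eventually_ge_atTop _
  filter_upwards [hbig, hsmall, hlarge, eventually_gt_atTop 0] with S hb2 hs1 hAS hS0 r hr
  have hr0 : 0 < r := hA0.trans hr
  have hti := hv.integrable_truncatedPower (ν := ν) hA0.le hS0.le r
  rcases le_or_gt (ε * S) r with hεr | hεr
  · have hint := hv.integrable_comp_div hφ₁ hS0
    have h1 : ∫ y, truncatedPower ν A S r * (1 - min 1 (2 / ε * (y / S))) ∂densityLaw v ≤
        ∫ y, truncatedPower ν A S |r - y| ∂densityLaw v := by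
      refine integral_mono_ae (((integrable_const _).sub hint).const_mul _) hti ?_
      filter_upwards [hv.ae_pos] with y hy
      exact truncatedPower_sub_ge h0.le (by linarith) hA0.le hε0 hε1.le hS0 hAS hεr hy
    rw [integral_const_mul, integral_sub (integrable_const _) hint] at h1
    simp only [integral_const, probReal_univ, one_smul] at h1
    refine le_trans ?_ h1
    rw [mul_comm]
    gcongr
    exact truncatedPower_nonneg _ _ _ _
  · have hint := (hv.integrable_comp_div hφ₂ hS0).const_mul (S ^ ν)
    have hi := hv.integrable_abs_sub_rpow h0.le hνα hr0.le
    have hrS : r < S := hεr.trans_le (mul_le_of_le_one_left hS0.le hε1.le)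
    have h1 : ∫ y, (|r - y| ^ ν - A ^ ν - S ^ ν * (Ioi 1).indicator (fun u => u ^ ν) (y / S))
        ∂densityLaw v ≤ ∫ y, truncatedPower ν A S |r - y| ∂densityLaw v := by
      refine integral_mono_ae ((hi.sub (integrable_const _)).sub hint) hti ?_
      filter_upwards [hv.ae_pos] with y hy
      exact le_truncatedPower_sub h0.le hA0.le hr0.le hS0 hrS hy
    rw [integral_sub (f := fun y => |r - y| ^ ν - A ^ ν) (hi.sub (integrable_const _)) hint,
      integral_sub hi (integrable_const _), integral_const_mul] at h1
    simp only [integral_const, probReal_univ, one_smul] at h1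
    have h2 := hA₁ r (hAA.trans hr.le)
    have h3 : S ^ ν * (C₂ * S ^ (-α)) ≤ b * r ^ (ν - α) := by
      have h4 : (ε * S) ^ (ν - α) ≤ r ^ (ν - α) :=
        Real.rpow_le_rpow_of_nonpos hr0 hεr.le (by linarith)
      calc S ^ ν * (C₂ * S ^ (-α)) = C₂ * S ^ (ν - α) := by
            rw [sub_eq_add_neg, Real.rpow_add hS0]
            ring
        _ ≤ b * ε ^ (ν - α) * S ^ (ν - α) := by gcongr
        _ = b * (ε * S) ^ (ν - α) := by
            rw [Real.mul_rpow hε0.le hS0.le]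
            ring
        _ ≤ _ := by gcongr
    have h5 : S ^ ν * ∫ y, (Ioi 1).indicator (fun u => u ^ ν) (y / S) ∂densityLaw v ≤
        S ^ ν * (C₂ * S ^ (-α)) := by gcongr
    have h6 : truncatedPower ν A S r = r ^ ν - A ^ ν := by
      rw [truncatedPower, min_eq_left (Real.rpow_le_rpow hr0.le hrS.le h0.le), max_eq_right]
      linarith [Real.rpow_le_rpow hA0.le hr.le h0.le]
    have h7 : (1 - C₁ * S ^ (-α)) * truncatedPower ν A S r ≤ truncatedPower ν A S r := by
      refine mul_le_of_le_one_left (truncatedPower_nonneg _ _ _ _) ?_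
      have : 0 ≤ C₁ * S ^ (-α) := by positivity
      linarith
    rw [h6] at h7 ⊢
    linarith

end IsHeavyTailedDensity

namespace IsOscillatingKernel

variable {v₁ v₂ : ℝ → ℝ} {κ : Kernel ℝ ℝ} {α c₁ c₂ : ℝ}

/-- Once R ≥ |x|, a jump longer than 2 R overshoots the origin and lands at distance at least R. -/
lemma le_measure_abs_ge (hκ : IsOscillatingKernel (fun y => v₁ (-y)) v₂ κ)
    (hv₁ : IsHeavyTailedDensity α c₁ v₁) (hv₂ : IsHeavyTailedDensity α c₂ v₂)
    (hα : 0 < α) (hc₁ : 0 < c₁) (hc₂ : 0 < c₂) {x : ℝ} (hx : x ≠ 0) :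
    ∃ b > 0, ∀ᶠ R in atTop, ENNReal.ofReal (b * R ^ (-α)) ≤ κ x {z | R ≤ |z|} := by
  obtain ⟨b₁, hb₁, h₁⟩ := hv₁.le_measure_Ioi hα hc₁
  obtain ⟨b₂, hb₂, h₂⟩ := hv₂.le_measure_Ioi hα hc₂
  have h2 : Tendsto (fun R : ℝ => 2 * R) atTop atTop := tendsto_id.const_mul_atTop two_pos
  refine ⟨min b₁ b₂ * 2 ^ (-α), by positivity, ?_⟩
  filter_upwards [h2.eventually h₁, h2.eventually h₂, eventually_ge_atTop |x|,
    eventually_gt_atTop 0] with R hR₁ hR₂ hRx hR0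
  have key : ∀ {v : ℝ → ℝ} {c b : ℝ}, IsHeavyTailedDensity α c v → min b₁ b₂ ≤ b →
      b * (2 * R) ^ (-α) ≤ (densityLaw v).real (Ioi (2 * R)) →
      ENNReal.ofReal (min b₁ b₂ * 2 ^ (-α) * R ^ (-α)) ≤
        ∫⁻ y, (Ici R).indicator 1 |(|x| - y)| ∂densityLaw v := by
    intro v c b hv hb hR
    have := hv.density.isProbabilityMeasure
    have h3 : min b₁ b₂ * 2 ^ (-α) * R ^ (-α) ≤ (densityLaw v).real (Ioi (2 * R)) := by
      refine le_trans ?_ hR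
      rw [mul_assoc, ← Real.mul_rpow two_pos.le hR0.le]
      gcongr
    refine (ENNReal.ofReal_le_ofReal h3).trans ?_
    rw [ofReal_measureReal, ← lintegral_indicator_one measurableSet_Ioi]
    refine lintegral_mono fun y => ?_
    by_cases hy : y ∈ Ioi (2 * R)
    · have h4 : |(|x| - y)| ∈ Ici R := by
        rw [mem_Ici, abs_sub_comm]
        exact le_trans (by linarith [mem_Ioi.1 hy]) (le_abs_self _)
      rw [indicator_of_mem hy, indicator_of_mem h4]
      rfl
    · rw [indicator_of_notMem hy]
      exact zero_le
  have hset : MeasurableSet {z : ℝ | R ≤ |z|} := measurableSet_le measurable_const (by fun_prop)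
  rw [← lintegral_indicator_one hset]
  exact hκ.lintegral_abs_induction hx (g := (Ici R).indicator 1)
    (measurable_one.indicator measurableSet_Ici)
    (p := fun I => ENNReal.ofReal (min b₁ b₂ * 2 ^ (-α) * R ^ (-α)) ≤ I)
    (key hv₁ (min_le_left _ _) hR₁) (key hv₂ (min_le_right _ _) hR₂)

/-- To bound the transition operator from below at an even function vanishing on the target, it
suffices to bound the expectations under the two increment laws. -/
lemma le_setLIntegral (hκ : IsOscillatingKernel (fun y => v₁ (-y)) v₂ κ) {a x A : ℝ} (ha : 0 < a)
    (hx : a < |x|) {g : ℝ → ℝ} (hg : Measurable g) (hg0 : ∀ s, 0 ≤ s → s ≤ a → g s ≤ 0)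
    (h₁ : ENNReal.ofReal A ≤ ∫⁻ y, ENNReal.ofReal (g |(|x| - y)|) ∂densityLaw v₁)
    (h₂ : ENNReal.ofReal A ≤ ∫⁻ y, ENNReal.ofReal (g |(|x| - y)|) ∂densityLaw v₂) :
    ENNReal.ofReal A ≤ ∫⁻ z in {z | a < |z|}, ENNReal.ofReal (g |z|) ∂κ x := by
  have hx0 : x ≠ 0 := by
    rintro rfl
    simp at hx
    linarith
  have h3 : ∀ z, {z : ℝ | a < |z|}.indicator (fun z => ENNReal.ofReal (g |z|)) z =
      ENNReal.ofReal (g |z|) := by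
    intro z
    by_cases hz : a < |z|
    · rw [indicator_of_mem (by exact hz)]
    · rw [indicator_of_notMem (by exact hz),
        ENNReal.ofReal_of_nonpos (hg0 _ (abs_nonneg z) (not_lt.1 hz))]
  rw [← lintegral_indicator (measurableSet_lt_abs a), lintegral_congr h3]
  exact hκ.lintegral_abs_induction hx0 hg.ennreal_ofReal (p := fun I => ENNReal.ofReal A ≤ I) h₁ h₂

end IsOscillatingKernel

/-! ### Infinite moments above the critical exponent -/

namespace IsMarkovChainFrom

variable {Ω : Type*} {m : MeasurableSpace Ω} {P : Measure Ω} [IsProbabilityMeasure P]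
  {ℱ : Filtration ℕ m} {κ : Kernel ℝ ℝ} [IsMarkovKernel κ] {x : ℝ} {Z : ℕ → Ω → ℝ} {a : ℝ}
  {α c₁ c₂ : ℝ} {v₁ v₂ : ℝ → ℝ}

/-- A lower bound for the survival probability by a first step followed by a supersolution. -/
lemma setLIntegral_le_measure_lt_passageTime (hZ : IsMarkovChainFrom P ℱ κ x Z) (hx : a < |x|)
    {W : ℕ → ℝ → ℝ≥0∞} (hW : ∀ k, Measurable (W k)) {N : ℕ}
    (hstep : ∀ k < N, ∀ y, a < |y| → W (k + 1) y ≤ ∫⁻ z in {z | a < |z|}, W k z ∂κ y)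
    (h0 : ∀ y, W 0 y ≤ 1) :
    ∫⁻ z in {z | a < |z|}, W N z ∂κ x ≤ P {ω | (N : ℕ∞) < passageTime Z a ω} := by
  -- W is indexed by the number of steps still to go, hence the reversal. Index 0 is the first jump,
  -- so N + 1 steps are survived, one more than required.
  set V : ℕ → ℝ → ℝ≥0∞ := fun k y =>
    if k = 0 then ∫⁻ z in {z | a < |z|}, W N z ∂κ y else W (N + 1 - k) y with hV
  have hVm : ∀ k, Measurable (V k) := by
    intro k
    by_cases hk : k = 0
    · simp only [hV, hk, if_true]
      exact (hW N).setLIntegral_kernel (measurableSet_lt_abs a)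
    · simp only [hV, hk, if_false]
      exact hW _
  have h := hZ.le_measure_lt_passageTime hx hVm (N := N + 1) ?_ ?_
  · simp only [hV, if_true] at h
    refine h.trans (measure_mono fun ω hω => ?_)
    have hω' : ((N + 1 : ℕ) : ℕ∞) < passageTime Z a ω := hω
    exact lt_of_le_of_lt (Nat.cast_le.2 (Nat.le_succ N)) hω'
  · intro k hk y hy
    rcases Nat.eq_zero_or_pos k with rfl | hk0
    · simp [hV]
    · simp only [hV, hk0.ne', if_false, Nat.add_sub_add_right, Nat.succ_ne_zero]
      have h1 : N + 1 - k = N - k + 1 := by omega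
      rw [h1]
      exact hstep _ (by omega) y hy
  · intro y
    simpa [hV] using h0 y

lemma passageMoment_eq_top_of_one_le (hZ : IsMarkovChainFrom P ℱ κ x Z)
    (hκ : IsOscillatingKernel (fun y => v₁ (-y)) v₂ κ) (hc₁ : 0 < c₁) (hc₂ : 0 < c₂)
    (hv₁ : IsHeavyTailedDensity α c₁ v₁) (hv₂ : IsHeavyTailedDensity α c₂ v₂)
    (ha : 0 < a) (hx : a < |x|) (hα : 1 ≤ α) {q : ℝ} (hq : α < q) :
    passageMoment P Z a q = ⊤ := by
  have hα0 : 0 < α := by linarith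
  have hq0 : 0 < q := by linarith
  have hx0 : x ≠ 0 := by
    rintro rfl
    simp at hx
    linarith
  -- β < 1 ≤ α gives finite moments of order β, and β > α / q gives α / β < q. The scale M below
  -- satisfies M ^ (-β) B = 1 / (4 N).
  obtain ⟨β, hβ1, hβ2⟩ := exists_between ((div_lt_one hq0).2 hq)
  have hβ0 : 0 < β := (div_pos hα0 hq0).trans hβ1
  have hp : α / β < q := by
    rw [div_lt_iff₀ hq0] at hβ1
    rw [div_lt_iff₀ hβ0]
    linarith
  obtain ⟨b, hb, hjump⟩ := hκ.le_measure_abs_ge hv₁ hv₂ hα0 hc₁ hc₂ hx0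
  set B := max 1 (max (∫ y, y ^ β ∂densityLaw v₁) (∫ y, y ^ β ∂densityLaw v₂)) with hB
  have hB1 : 1 ≤ B := le_max_left _ _
  have hM : Tendsto (fun N : ℕ => (4 * B * (N : ℝ)) ^ β⁻¹) atTop atTop :=
    (tendsto_rpow_atTop (inv_pos.2 hβ0)).comp
      (tendsto_natCast_atTop_atTop.const_mul_atTop (by positivity))
  refine hZ.passageMoment_eq_top (q := α / β) (c := 1 / 2 * (b * (4 * B) ^ (-(α / β))))
    (by positivity) (by positivity) ?_ hp
  filter_upwards [hM.eventually hjump, hM.eventually (eventually_ge_atTop (4 * a)),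
    eventually_gt_atTop 0] with N hN hMa hN0
  have hN0' : (0 : ℝ) < N := by exact_mod_cast hN0
  set M := (4 * B * (N : ℝ)) ^ β⁻¹ with hMdef
  have hM0 : 0 < M := by positivity
  have hMβ : M ^ (-β) = (4 * B * N)⁻¹ := by
    rw [hMdef, ← Real.rpow_mul (by positivity), mul_neg, inv_mul_cancel₀ hβ0.ne', Real.rpow_neg_one]
  set D := (4 * (N : ℝ))⁻¹ with hD
  have hD0 : 0 < D := by positivity
  -- Subtracting a / M makes g nonpositive on the target, and D is the cost of one step. From s ≥ M
  -- with N steps to go at least 1 - 1/4 - 1/4 remains.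
  set g : ℕ → ℝ → ℝ := fun k s => min 1 (s / M) - a / M - k * D with hg
  have hgm : ∀ k, Measurable (g k) := fun k => by fun_prop
  have hW := hZ.setLIntegral_le_measure_lt_passageTime hx (N := N)
    (W := fun k z => ENNReal.ofReal (g k |z|))
    (fun k => ((hgm k).comp (by fun_prop)).ennreal_ofReal) ?_ ?_
  · refine le_trans ?_ hW
    have haM : a / M ≤ 1 / 4 := by
      rw [div_le_iff₀ hM0]
      linarith
    have hND : (N : ℝ) * D = 1 / 4 := by
      rw [hD]
      field_simp
    have hfar : ∀ z ∈ {z : ℝ | M ≤ |z|}, ENNReal.ofReal (1 / 2) ≤ ENNReal.ofReal (g N |z|) := by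
      intro z hz
      refine ENNReal.ofReal_le_ofReal ?_
      have h1 : 1 ≤ |z| / M := (one_le_div hM0).2 hz
      simp only [hg]
      rw [min_eq_left h1, hND]
      linarith
    have hsub : {z : ℝ | M ≤ |z|} ⊆ {z | a < |z|} := fun z (hz : M ≤ |z|) =>
      (by linarith : a < |z|)
    have hset : MeasurableSet {z : ℝ | M ≤ |z|} := measurableSet_le measurable_const (by fun_prop)
    calc ENNReal.ofReal (1 / 2 * (b * (4 * B) ^ (-(α / β))) * (N : ℝ) ^ (-(α / β)))
        = ENNReal.ofReal (1 / 2) * ENNReal.ofReal (b * M ^ (-α)) := by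
          rw [← ENNReal.ofReal_mul (by norm_num), hMdef, ← Real.rpow_mul (by positivity),
            show β⁻¹ * -α = -(α / β) by ring, Real.mul_rpow (by positivity) hN0'.le]
          ring_nf
      _ ≤ ENNReal.ofReal (1 / 2) * κ x {z | M ≤ |z|} := by gcongr
      _ = ∫⁻ _z in {z | M ≤ |z|}, ENNReal.ofReal (1 / 2) ∂κ x := by rw [setLIntegral_const]
      _ ≤ ∫⁻ z in {z | M ≤ |z|}, ENNReal.ofReal (g N |z|) ∂κ x := setLIntegral_mono' hset hfar
      _ ≤ _ := lintegral_mono_set hsub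
  · intro k _ y hy
    have key : ∀ {v : ℝ → ℝ} {c : ℝ}, IsHeavyTailedDensity α c v →
        ∫ y, y ^ β ∂densityLaw v ≤ B →
        ENNReal.ofReal (g (k + 1) |y|) ≤
          ∫⁻ u, ENNReal.ofReal (g k |(|y| - u)|) ∂densityLaw v := by
      intro v c hv hvB
      have := hv.density.isProbabilityMeasure
      have hint := hv.integrable_rpow hβ0.le (by linarith : β < α)
      have hi : Integrable (fun u => g k |y| - M ^ (-β) * u ^ β) (densityLaw v) :=
        (integrable_const _).sub (hint.const_mul _)
      have h1 : g (k + 1) |y| ≤ ∫ u, (g k |y| - M ^ (-β) * u ^ β) ∂densityLaw v := by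
        rw [integral_sub (integrable_const _) (hint.const_mul _), integral_const_mul]
        simp only [integral_const, probReal_univ, one_smul]
        have h2 : M ^ (-β) * ∫ u, u ^ β ∂densityLaw v ≤ D := by
          calc _ ≤ M ^ (-β) * B := by gcongr
            _ = D := by
              rw [hMβ, hD]
              field_simp
        simp only [hg]
        push_cast
        linarith
      refine (ENNReal.ofReal_le_ofReal h1).trans ((ofReal_integral_le_lintegral_ofReal hi).trans ?_)
      refine lintegral_mono_ae ?_
      filter_upwards [hv.ae_pos] with u hu
      refine ENNReal.ofReal_le_ofReal ?_
      have hu0 : 0 ≤ u / M := by positivity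
      have h3 : min 1 (u / M) ≤ M ^ (-β) * u ^ β := by
        have h4 : M ^ (-β) * u ^ β = (u / M) ^ β := by
          rw [Real.div_rpow hu.le hM0.le, Real.rpow_neg hM0.le]
          ring
        rw [h4]
        rcases le_total 1 (u / M) with h5 | h5
        · rw [min_eq_left h5]
          exact Real.one_le_rpow h5 hβ0.le
        · rw [min_eq_right h5]
          simpa using Real.rpow_le_rpow_of_exponent_ge' hu0 h5 hβ0.le hβ2.le
      have h6 : |y| / M - u / M ≤ |(|y| - u)| / M := by
        rw [← sub_div]
        gcongr
        exact le_abs_self _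
      have h8 : 0 ≤ |(|y| - u)| / M := by positivity
      -- Subadditivity of t ↦ min 1 t: a step u lowers it by at most min 1 (u / M) ≤ (u / M) ^ β.
      have h7 : min 1 (|y| / M) - min 1 (u / M) ≤ min 1 (|(|y| - u)| / M) := by
        rcases le_total 1 (u / M) with h5 | h5
        · rw [min_eq_left h5]
          exact le_trans (by linarith [min_le_left 1 (|y| / M)]) (le_min zero_le_one h8)
        · rw [min_eq_right h5]
          refine le_min ?_ ?_
          · linarith [min_le_left 1 (|y| / M)]
          · linarith [min_le_right 1 (|y| / M)]
      simp only [hg]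
      linarith
    refine hκ.le_setLIntegral ha hy (hgm k) (fun s hs hsa => ?_)
      (key hv₁ ((le_max_left _ _).trans (le_max_right _ _)))
      (key hv₂ ((le_max_right _ _).trans (le_max_right _ _)))
    have h1 : s / M ≤ a / M := by gcongr
    have h2 : 0 ≤ k * D := by positivity
    simp only [hg]
    linarith [min_le_right 1 (s / M)]
  · intro y
    rw [ENNReal.ofReal_le_one]
    have h1 : 0 ≤ a / M := by positivity
    simp only [hg, Nat.cast_zero, zero_mul, sub_zero]
    linarith [min_le_left 1 (|y| / M)]

lemma passageMoment_eq_top_of_lt_one (hZ : IsMarkovChainFrom P ℱ κ x Z)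
    (hκ : IsOscillatingKernel (fun y => v₁ (-y)) v₂ κ) (hc₁ : 0 < c₁) (hc₂ : 0 < c₂)
    (hv₁ : IsHeavyTailedDensity α c₁ v₁) (hv₂ : IsHeavyTailedDensity α c₂ v₂)
    (ha : 0 < a) (hx : a < |x|) (hα : 1 / 2 < α) (hα1 : α < 1) {q : ℝ} (hq : 2 - 1 / α < q) :
    passageMoment P Z a q = ⊤ := by
  have hα0 : 0 < α := by linarith
  have hx0 : x ≠ 0 := by
    rintro rfl
    simp at hx
    linarith
  have h2α : 2 - 1 / α = (2 * α - 1) / α := by field_simp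
  rw [h2α, div_lt_iff₀ hα0] at hq
  obtain ⟨ν, hν, hν2⟩ := exists_between (lt_min hq (by linarith : 2 * α - 1 < α))
  have hνα : ν < α := hν2.trans_le (min_le_right _ _)
  have hp : ν / α < q := by
    rw [div_lt_iff₀ hα0]
    exact hν2.trans_le (min_le_left _ _)
  have hν0 : 0 < ν := by linarith
  obtain ⟨b, hb, hjump⟩ := hκ.le_measure_abs_ge hv₁ hv₂ hα0 hc₁ hc₂ hx0
  obtain ⟨C₁, hC₁, hs₁⟩ := hv₁.truncatedPower_le_integral hc₁ hα hα1 hν hνα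
  obtain ⟨C₂, hC₂, hs₂⟩ := hv₂.truncatedPower_le_integral hc₂ hα hα1 hν hνα
  -- A and R are fixed before N: a first jump beyond R > A costs only a constant and brings the walk
  -- to where the truncated power is positive.
  obtain ⟨A, hA₁, hA₂, hAa⟩ := (hs₁.and (hs₂.and (eventually_ge_atTop a))).exists
  have hA0 : 0 < A := ha.trans_le hAa
  obtain ⟨R, hR, hRA⟩ := (hjump.and (eventually_gt_atTop A)).exists
  have hR0 : 0 < R := hA0.trans hRA
  have hRν : A ^ ν < R ^ ν := Real.rpow_lt_rpow hA0.le hRA hν0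
  have hgap : 0 < R ^ ν - A ^ ν := by linarith
  set C := max C₁ C₂ with hC
  have hC0 : 0 < C := hC₁.trans_le (le_max_left _ _)
  have hS : Tendsto (fun N : ℕ => (2 * C * (N : ℝ)) ^ α⁻¹) atTop atTop :=
    (tendsto_rpow_atTop (inv_pos.2 hα0)).comp
      (tendsto_natCast_atTop_atTop.const_mul_atTop (by positivity))
  refine hZ.passageMoment_eq_top (q := ν / α)
    (c := 1 / 2 * (R ^ ν - A ^ ν) * (2 * C) ^ (-(ν / α)) * (b * R ^ (-α)))
    (by positivity) (by positivity) ?_ hp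
  filter_upwards [hS.eventually hA₁, hS.eventually hA₂, hS.eventually (eventually_ge_atTop R),
    eventually_gt_atTop 0] with N hN₁ hN₂ hSR hN0
  have hN0' : (0 : ℝ) < N := by exact_mod_cast hN0
  set S := (2 * C * (N : ℝ)) ^ α⁻¹ with hSdef
  have hS0 : 0 < S := by positivity
  have hSα : C * S ^ (-α) = (2 * (N : ℝ))⁻¹ := by
    rw [hSdef, ← Real.rpow_mul (by positivity), mul_neg, inv_mul_cancel₀ hα0.ne', Real.rpow_neg_one]
    field_simp
  set θ := 1 - C * S ^ (-α) with hθ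
  have hN1 : (1 : ℝ) ≤ N := by exact_mod_cast hN0
  have hinv : (2 * (N : ℝ))⁻¹ ≤ 1 := inv_le_one_of_one_le₀ (by linarith)
  have hθ0 : 0 ≤ θ := by
    rw [hθ, hSα]
    linarith
  -- S was chosen so that θ = 1 - 1 / (2 N); Bernoulli's inequality then bounds the total loss over
  -- N steps.
  have hθN : 1 / 2 ≤ θ ^ N := by
    have h := one_add_mul_le_pow (a := -(2 * (N : ℝ))⁻¹) (by linarith) N
    have h2 : θ = 1 + -(2 * (N : ℝ))⁻¹ := by
      rw [hθ, hSα]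
      ring
    rw [h2]
    refine le_trans (le_of_eq ?_) h
    field_simp
    norm_num
  -- The factor S ^ (-ν) normalizes g 0 to at most 1 and produces the order N ^ (-ν / α) of the
  -- bound.
  set g : ℕ → ℝ → ℝ := fun k s => θ ^ k * S ^ (-ν) * truncatedPower ν A S s with hg
  have hgm : ∀ k, Measurable (g k) := fun k => (measurable_truncatedPower ν A S).const_mul _
  have hg0 : ∀ k s, 0 ≤ s → s ≤ A → g k s = 0 := by
    intro k s hs hsA
    simp only [hg]
    rw [truncatedPower_eq_zero hν0.le hs hsA, mul_zero]
  have hW := hZ.setLIntegral_le_measure_lt_passageTime hx (N := N)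
    (W := fun k z => ENNReal.ofReal (g k |z|))
    (fun k => ((hgm k).comp (by fun_prop)).ennreal_ofReal) ?_ ?_
  · refine le_trans ?_ hW
    have hfar : ∀ z ∈ {z : ℝ | R ≤ |z|},
        ENNReal.ofReal (1 / 2 * (R ^ ν - A ^ ν) * S ^ (-ν)) ≤ ENNReal.ofReal (g N |z|) := by
      intro z hz
      refine ENNReal.ofReal_le_ofReal ?_
      have h1 : R ^ ν ≤ |z| ^ ν := Real.rpow_le_rpow hR0.le hz hν0.le
      have h2 : R ^ ν ≤ S ^ ν := Real.rpow_le_rpow hR0.le hSR hν0.le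
      have h3 : R ^ ν - A ^ ν ≤ truncatedPower ν A S |z| := by
        refine le_trans ?_ (le_max_right _ _)
        linarith [le_min h1 h2]
      simp only [hg]
      calc _ = 1 / 2 * S ^ (-ν) * (R ^ ν - A ^ ν) := by ring
        _ ≤ _ := by gcongr
    have hsub : {z : ℝ | R ≤ |z|} ⊆ {z | a < |z|} := fun z (hz : R ≤ |z|) =>
      (by linarith : a < |z|)
    have hset : MeasurableSet {z : ℝ | R ≤ |z|} := measurableSet_le measurable_const (by fun_prop)
    calc ENNReal.ofReal (1 / 2 * (R ^ ν - A ^ ν) * (2 * C) ^ (-(ν / α)) * (b * R ^ (-α)) *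
          (N : ℝ) ^ (-(ν / α)))
        = ENNReal.ofReal (1 / 2 * (R ^ ν - A ^ ν) * S ^ (-ν)) * ENNReal.ofReal (b * R ^ (-α)) := by
          rw [← ENNReal.ofReal_mul (by positivity), hSdef, ← Real.rpow_mul (by positivity),
            show α⁻¹ * -ν = -(ν / α) by ring, Real.mul_rpow (by positivity) hN0'.le]
          ring_nf
      _ ≤ ENNReal.ofReal (1 / 2 * (R ^ ν - A ^ ν) * S ^ (-ν)) * κ x {z | R ≤ |z|} := by gcongr
      _ = ∫⁻ _z in {z | R ≤ |z|}, ENNReal.ofReal (1 / 2 * (R ^ ν - A ^ ν) * S ^ (-ν)) ∂κ x := by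
          rw [setLIntegral_const]
      _ ≤ ∫⁻ z in {z | R ≤ |z|}, ENNReal.ofReal (g N |z|) ∂κ x := setLIntegral_mono' hset hfar
      _ ≤ _ := lintegral_mono_set hsub
  · intro k _ y hy
    rcases le_or_gt |y| A with hyA | hyA
    · rw [hg0 _ _ (abs_nonneg y) hyA, ENNReal.ofReal_zero]
      exact zero_le
    have key : ∀ {v : ℝ → ℝ} {c C' : ℝ}, IsHeavyTailedDensity α c v → C' ≤ C →
        (∀ r, A < r → (1 - C' * S ^ (-α)) * truncatedPower ν A S r ≤
          ∫ y, truncatedPower ν A S |r - y| ∂densityLaw v) →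
        ENNReal.ofReal (g (k + 1) |y|) ≤
          ∫⁻ u, ENNReal.ofReal (g k |(|y| - u)|) ∂densityLaw v := by
      intro v c C' hv hC' hv'
      have hi : Integrable (fun u => g k |(|y| - u)|) (densityLaw v) :=
        (hv.integrable_truncatedPower hA0.le hS0.le _).const_mul _
      refine le_trans (ENNReal.ofReal_le_ofReal ?_) (ofReal_integral_le_lintegral_ofReal hi)
      simp only [hg]
      rw [integral_const_mul]
      have h1 := hv' _ hyA
      have h2 : θ * truncatedPower ν A S |y| ≤ (1 - C' * S ^ (-α)) * truncatedPower ν A S |y| := by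
        refine mul_le_mul_of_nonneg_right ?_ (truncatedPower_nonneg _ _ _ _)
        rw [hθ]
        gcongr
      calc θ ^ (k + 1) * S ^ (-ν) * truncatedPower ν A S |y|
          = θ ^ k * S ^ (-ν) * (θ * truncatedPower ν A S |y|) := by ring
        _ ≤ _ := by
          gcongr
          exact h2.trans h1
    exact hκ.le_setLIntegral ha hy (hgm k) (fun s hs hsa => (hg0 k s hs (hsa.trans hAa)).le)
      (key hv₁ (le_max_left _ _) hN₁) (key hv₂ (le_max_right _ _) hN₂)
  · intro y
    rw [ENNReal.ofReal_le_one]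
    simp only [hg, pow_zero, one_mul]
    rw [Real.rpow_neg hS0.le, inv_mul_le_iff₀ (by positivity), mul_one]
    exact truncatedPower_le hA0.le hS0.le

end IsMarkovChainFrom

theorem theorem3p4 {α c₁ c₂ : ℝ} (hα : 1 / 2 < α) (hc₁ : 0 < c₁) (hc₂ : 0 < c₂)
    {v₁ v₂ : ℝ → ℝ} (hv₁ : IsHeavyTailedDensity α c₁ v₁) (hv₂ : IsHeavyTailedDensity α c₂ v₂)
    {κ : Kernel ℝ ℝ} [IsMarkovKernel κ] (hκ : IsOscillatingKernel (fun y => v₁ (-y)) v₂ κ)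
    {a x : ℝ} (ha : 0 < a) (hx : x ∉ Icc (-a) a)
    {Ω : Type*} {m : MeasurableSpace Ω} {P : Measure Ω} [IsProbabilityMeasure P]
    {ℱ : Filtration ℕ m} {Z : ℕ → Ω → ℝ} (hZ : IsMarkovChainFrom P ℱ κ x Z) :
    (1 ≤ α → ∀ q : ℝ, (q < α → passageMoment P Z a q < ⊤) ∧
      (α < q → passageMoment P Z a q = ⊤)) ∧
    (α < 1 → ∀ q : ℝ, (q < 2 - 1 / α → passageMoment P Z a q < ⊤) ∧
      (2 - 1 / α < q → passageMoment P Z a q = ⊤)) := by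
  have hxa : a < |x| := not_le.1 fun h => hx (mem_Icc.2 (abs_le.1 h))
  exact ⟨fun h q =>
    ⟨hZ.passageMoment_lt_top_of_one_le hκ hc₁ hc₂ hv₁ hv₂ ha hxa h,
      hZ.passageMoment_eq_top_of_one_le hκ hc₁ hc₂ hv₁ hv₂ ha hxa h⟩, fun h q =>
    ⟨hZ.passageMoment_lt_top_of_lt_one hκ hc₁ hc₂ hv₁ hv₂ ha hxa hα h,
      hZ.passageMoment_eq_top_of_lt_one hκ hc₁ hc₂ hv₁ hv₂ ha hxa hα h⟩⟩
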